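/- **Setting.** Let $X_1,X_2,\dots$ be i.i.d. random elements of a measurable space $\mathcal X$ with law $P$, and let $X\sim P$. There are $K$ models with complexities $c(1),\dots,c(K)\in[0,\infty)$. Model $k$ has an open parameter set $\Theta_k\subseteq\mathbb R^{d_k}$ and a loss $\ell_k:\mathcal X\times\Theta_k\to\mathbb R$, jointly measurable (for instance $\ell_k(x;\theta)=-\log f_k(x;\theta)$). For each $k$ let $\theta_k^*\in\operatorname{argmin}_{\theta\in\Theta_k}\mathbb E\,\ell_k(X;\theta)$, and set $\mu^0_k=\mathbb E\,\ell_k(X;\theta^*_k)$ and $\Sigma^0=\mathrm{Cov}\big(\ell_1(X;\theta_1^*),\dots,\ell_K(X;\theta_K^*)\big)$. **Assumptions.** 1. $\mathbb E\,\ell_k(X;\theta_k^*)^2<\infty$ for all $k$, and $\Sigma^0$ is positive definite. 2. For every $k$ there is $r>0$ with $B_r(\theta^*_k)\subseteq\Theta_k$ such that (a) $\mathbb E|\ell_k(X;\theta)|<\infty$ for all $\theta\in B_r(\theta_k^*)$; (b) for every $x$ the map $\theta\mapsto\ell_k(x;\theta)$ is $C^2$ on $B_r(\theta_k^*)$; (c)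 there is $H:\mathcal X\to[0,\infty)$ with $\mathbb E H(X)<\infty$ and $\|\nabla^2_\theta\ell_k(x;\theta)\|\le H(x)$ (Frobenius norm) for all $x$ and all $\theta\in B_r(\theta_k^*)$; (d) $\mathbb E\|\nabla_\theta\ell_k(X;\theta_k^*)\|^2<\infty$; (e) $\hat\theta_k=\hat\theta_{k}(X_1,\dots,X_n)\in\Theta_k$ is an estimator (a measurable function of the data) with $\|\hat\theta_k-\theta_k^*\|=O_p(1/\sqrt n)$. **Posterior.** Let $Z_1,\dots,Z_n\in\mathbb R^K$ be the "likelihood as data" (LaD) vectors $Z_{ik}=\ell_k(X_i;\hat\theta_k)$, with mean $\bar Z_n=\frac1n\sum_i Z_i$ and covariance $S_n=\frac1n\sum_i(Z_i-\bar Z_n)(Z_i-\bar Z_n)^{T}$. Fix $\mu_0\in\mathbb R^K$, $\lambda_0>0$, $\Psi_0$ positive definite and $\nu_0>K-1$. The Normal–Inverse-Wishart posterior of $(\mu,\Sigma)$ given $Z_{1:n}$ is: $\Sigma\sim\mathrm{InverseWishart}(\Psi_n,\nu_n)$ and $\mu\mid\Sigma\sim\mathcal N(\mu_n,\Sigma/\lambda_n)$,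 where $$\lambda_n=\lambda_0+n,\quad \mu_n=\frac{\lambda_0\mu_0+n\bar Z_n}{\lambda_n},\quad \nu_n=\nu_0+n,\quad \Psi_n=\Psi_0+nS_n+\frac{\lambda_0 n}{\lambda_n}(\bar Z_n-\mu_0)(\bar Z_n-\mu_0)^{T}.$$ Here $\mathrm{InverseWishart}(\Psi,\nu)$ has density proportional to $|\Sigma|^{-(\nu+K+1)/2}e^{-\mathrm{tr}(\Psi\Sigma^{-1})/2}$ on the positive definite matrices. **Score.** For $\delta>0$ and $\mu\in\mathbb R^K$ put $$M_\delta(\mu)=\{k:\mu_k\le\min_j\mu_j+\delta\},\quad c^*_\delta(\mu)=\min\{c(k):k\in M_\delta(\mu)\},\quad M^*_\delta(\mu)=\operatorname*{argmin}_{k:\,c(k)=c^*_\delta(\mu)}\mu_k .$$ For temperatures $\alpha_n\ge0$, the smooth LaD criterion (SLC) score is $$w_\delta(k\mid Z_{1:n})=P\big(c^*_\delta(\mu)=c(k)\mid Z_{1:n}\big)\;\mathbb E\Big(\exp\big(-\alpha_n(\mu_k-\min_{j:\,c(j)=c(k)}\mu_j)\big)\,\Big|\,Z_{1:n}\Big),$$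 where $\mu\mid Z_{1:n}$ follows the posterior above. **Theorem.** Under Assumptions 1 and 2, suppose that $\delta>0$, that $\delta\ne\mu^0_k-\min_j\mu^0_j$ for all $k$, that $\alpha_n\ge0$, $\alpha_n\to\infty$ and $\alpha_n=o(\sqrt n)$. Then, for every $k\in\{1,\dots,K\}$, as $n\to\infty$, $$w_\delta(k\mid Z_{1:n})\ \longrightarrow\ \mathbf 1\big(k\in M^*_\delta(\mu^0)\big)\quad\text{in probability}.$$ The same holds when the score is computed from the bias-corrected LaD vectors $Z_{ik}=\ell_k(X_i;\hat\theta_k)+\frac{d_k}{2n}$. -/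

import Mathlib

open MeasureTheory ProbabilityTheory Filter Topology Matrix

open scoped NNReal ENNReal MatrixOrder

/-! ### Selection of models by a loss vector `μ ∈ ℝ^K` and complexities `c` -/

section Selection

variable {K : ℕ}

/-- `δ`-optimal models: `M_δ(μ) = {k : μ_k ≤ min_j μ_j + δ}`. -/
def deltaOptimal (δ : ℝ) (μ : EuclideanSpace ℝ (Fin K)) : Set (Fin K) :=
  {k | μ k ≤ (⨅ j, μ j) + δ}

/-- Minimal complexity attained by a `δ`-optimal model: `c*_δ(μ) = min {c(k) : k ∈ M_δ(μ)}`. -/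
noncomputable def minComplexity (c : Fin K → ℝ≥0) (δ : ℝ) (μ : EuclideanSpace ℝ (Fin K)) : ℝ≥0 :=
  sInf (c '' deltaOptimal δ μ)

/-- Best minimal-complexity `δ`-optimal models: `M*_δ(μ) = argmin {μ_k : c(k) = c*_δ(μ)}`. -/
def bestModels (c : Fin K → ℝ≥0) (δ : ℝ) (μ : EuclideanSpace ℝ (Fin K)) : Set (Fin K) :=
  {k | c k = minComplexity c δ μ ∧ ∀ j, c j = minComplexity c δ μ → μ k ≤ μ j}

/-- The soft-selection score `exp (-α (μ_k - min_{j : c(j) = c(k)} μ_j))`. -/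
noncomputable def softScore (c : Fin K → ℝ≥0) (α : ℝ) (k : Fin K)
    (μ : EuclideanSpace ℝ (Fin K)) : ℝ :=
  Real.exp (-α * (μ k - ⨅ j : {j : Fin K // c j = c k}, μ j))

end Selection

/-! ### The Normal-Inverse-Wishart distribution -/

section NIW

/-- The Borel (product) sigma-algebra on real matrices. -/
instance instMeasurableSpaceRealMatrix (K : ℕ) :
    MeasurableSpace (Matrix (Fin K) (Fin K) ℝ) :=
  (inferInstance : MeasurableSpace (Fin K → Fin K → ℝ))

instance instBorelSpaceRealMatrix (K : ℕ) : BorelSpace (Matrix (Fin K) (Fin K) ℝ) :=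
  (inferInstance : BorelSpace (Fin K → Fin K → ℝ))

/-- Lebesgue measure on the symmetric `K × K` matrices, in the coordinates given by the
entries indexed by unordered pairs `{i, j}` (diagonal included). -/
noncomputable def symLebesgue (K : ℕ) : Measure (Matrix (Fin K) (Fin K) ℝ) :=
  (volume : Measure (Sym2 (Fin K) → ℝ)).map (fun v => Matrix.of fun i j => v s(i, j))

/-- Unnormalized inverse-Wishart density
`|S|^{-(ν + K + 1)/2} exp(-tr(Ψ S⁻¹)/2)` on positive definite matrices, zero elsewhere. -/
noncomputable def invWishartKernelDensity {K : ℕ} (Ψ : Matrix (Fin K) (Fin K) ℝ) (ν : ℝ) :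
    Matrix (Fin K) (Fin K) ℝ → ℝ≥0∞ :=
  Set.indicator {S | S.PosDef} fun S =>
    ENNReal.ofReal (S.det ^ (-(ν + K + 1) / 2) * Real.exp (-(Ψ * S⁻¹).trace / 2))

/-- The measure on matrices with the unnormalized inverse-Wishart density with respect to
Lebesgue measure on symmetric matrices. -/
noncomputable def invWishartUnnormalized {K : ℕ} (Ψ : Matrix (Fin K) (Fin K) ℝ) (ν : ℝ) :
    Measure (Matrix (Fin K) (Fin K) ℝ) :=
  (symLebesgue K).withDensity (invWishartKernelDensity Ψ ν)

/-- The inverse-Wishart distribution with inverse scale matrix `Ψ` (positive definite) and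
`ν > K - 1` degrees of freedom: the normalization of the measure above. -/
noncomputable def invWishart {K : ℕ} (Ψ : Matrix (Fin K) (Fin K) ℝ) (ν : ℝ) :
    Measure (Matrix (Fin K) (Fin K) ℝ) :=
  (invWishartUnnormalized Ψ ν Set.univ)⁻¹ • invWishartUnnormalized Ψ ν

instance instSFiniteInvWishart {K : ℕ} (Ψ : Matrix (Fin K) (Fin K) ℝ) (ν : ℝ) :
    SFinite (invWishart Ψ ν) := by
  unfold invWishart invWishartUnnormalized symLebesgue
  infer_instance

open scoped Matrix.Norms.L2Operator in
theorem measurable_matrix_sqrt (K : ℕ) :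
    Measurable (fun S : Matrix (Fin K) (Fin K) ℝ => CFC.sqrt S) := by
  have hcl : IsClosed {S : Matrix (Fin K) (Fin K) ℝ | 0 ≤ S} := by
    have : {S : Matrix (Fin K) (Fin K) ℝ | 0 ≤ S} =
        {S | Sᴴ = S} ∩ ⋂ x : Fin K → ℝ, {S | 0 ≤ star x ⬝ᵥ (S *ᵥ x)} := by
      ext S
      simp only [Set.mem_ofPred_eq, Set.mem_inter_iff, Set.mem_iInter, Matrix.nonneg_iff_posSemidef,
        Matrix.posSemidef_iff_dotProduct_mulVec]
      rfl
    rw [this]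
    refine (isClosed_eq (by fun_prop) continuous_id).inter (isClosed_iInter fun x => ?_)
    exact isClosed_le continuous_const (by fun_prop)
  have hm : MeasurableSet {S : Matrix (Fin K) (Fin K) ℝ | 0 ≤ S} := hcl.measurableSet
  refine measurable_of_restrict_of_restrict_compl hm ?_ ?_
  · exact (continuousOn_iff_continuous_domRestrict.1 CFC.continuousOn_sqrt).measurable
  · have : Set.domRestrict {S : Matrix (Fin K) (Fin K) ℝ | 0 ≤ S}ᶜ (fun S => CFC.sqrt S) =
        fun _ => 0 := by
      ext1 ⟨S, hS⟩
      simp only [Set.domRestrict_apply]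
      rw [CFC.sqrt, cfcₙ_apply_of_not_predicate]
      exact hS
    rw [this]
    exact measurable_const

theorem measurable_multivariateGaussian {K : ℕ} (m : EuclideanSpace ℝ (Fin K)) (t : ℝ) :
    Measurable fun S : Matrix (Fin K) (Fin K) ℝ => multivariateGaussian m (t • S) := by
  have hsq : Measurable fun S : Matrix (Fin K) (Fin K) ℝ => CFC.sqrt (t • S) :=
    (measurable_matrix_sqrt K).comp (continuous_const_smul t).measurable
  obtain ⟨g, hg⟩ : ∃ g : Matrix (Fin K) (Fin K) ℝ × EuclideanSpace ℝ (Fin K) →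
      EuclideanSpace ℝ (Fin K), ∀ A x, g (A, x) = m + toEuclideanCLM (𝕜 := ℝ) A x :=
    ⟨fun p => m + toEuclideanCLM (𝕜 := ℝ) p.1 p.2, fun _ _ => rfl⟩
  have hgc : Continuous g := by
    have h : g = fun p => m + WithLp.toLp 2 (p.1 *ᵥ WithLp.ofLp p.2) := by
      ext1 p
      exact (hg p.1 p.2).trans
        (congrArg (m + ·) (Matrix.toEuclideanCLM_toLp p.1 (WithLp.ofLp p.2)))
    rw [h]
    refine continuous_const.add ((PiLp.continuous_toLp 2 _).comp ?_)
    exact continuous_fst.matrix_mulVec ((PiLp.continuous_ofLp 2 _).comp continuous_snd)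
  have hj : Measurable fun p : Matrix (Fin K) (Fin K) ℝ × EuclideanSpace ℝ (Fin K) =>
      g (CFC.sqrt (t • p.1), p.2) :=
    hgc.measurable.comp ((hsq.comp measurable_fst).prodMk measurable_snd)
  refine Measure.measurable_of_measurable_coe _ fun s hs => ?_
  have h : (fun S : Matrix (Fin K) (Fin K) ℝ => multivariateGaussian m (t • S) s) = fun S =>
      stdGaussian (EuclideanSpace ℝ (Fin K)) (Prod.mk S ⁻¹'
        ((fun p : Matrix (Fin K) (Fin K) ℝ × EuclideanSpace ℝ (Fin K) =>
          g (CFC.sqrt (t • p.1), p.2)) ⁻¹' s)) := by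
    ext S
    rw [multivariateGaussian, Measure.map_apply (by fun_prop) hs]
    congr 1
    ext x
    simp only [Set.mem_preimage, hg]
  rw [h]
  exact measurable_measure_prodMk_left (hj hs)

/-- The Markov kernel `S ↦ N(m, S / l)`. -/
noncomputable def gaussianMeanKernel {K : ℕ} (m : EuclideanSpace ℝ (Fin K)) (l : ℝ) :
    Kernel (Matrix (Fin K) (Fin K) ℝ) (EuclideanSpace ℝ (Fin K)) where
  toFun S := multivariateGaussian m (l⁻¹ • S)
  measurable' := measurable_multivariateGaussian m l⁻¹

instance instIsMarkovKernelGaussianMeanKernel {K : ℕ} (m : EuclideanSpace ℝ (Fin K)) (l : ℝ) :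
    IsMarkovKernel (gaussianMeanKernel m l) :=
  ⟨fun S => (inferInstance : IsProbabilityMeasure (multivariateGaussian m (l⁻¹ • S)))⟩

/-- The Normal-Inverse-Wishart distribution `NIW(m, l, Ψ, ν)`, as the joint law of the pair
`(Σ, μ)` where `Σ ∼ InverseWishart(Ψ, ν)` and `μ | Σ ∼ N(m, Σ / l)`. -/
noncomputable def normalInvWishart {K : ℕ} (m : EuclideanSpace ℝ (Fin K)) (l : ℝ)
    (Ψ : Matrix (Fin K) (Fin K) ℝ) (ν : ℝ) :
    Measure (Matrix (Fin K) (Fin K) ℝ × EuclideanSpace ℝ (Fin K)) :=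
  invWishart Ψ ν ⊗ₘ gaussianMeanKernel m l

end NIW

/-! ### The posterior based on LaD vectors and the SLC score -/

section Posterior

variable {K : ℕ}

/-- Sample mean of `Z_1, …, Z_n`. -/
noncomputable def sampleMean {n : ℕ} (Z : Fin n → EuclideanSpace ℝ (Fin K)) :
    EuclideanSpace ℝ (Fin K) :=
  (n : ℝ)⁻¹ • ∑ i, Z i

/-- The rank-one matrix `v vᵀ`. -/
def outerSelf (v : EuclideanSpace ℝ (Fin K)) : Matrix (Fin K) (Fin K) ℝ :=
  Matrix.of fun i j => v i * v j

/-- Sample covariance `(1/n) ∑ (Z_i - Z̄)(Z_i - Z̄)ᵀ`. -/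
noncomputable def sampleCov {n : ℕ} (Z : Fin n → EuclideanSpace ℝ (Fin K)) :
    Matrix (Fin K) (Fin K) ℝ :=
  (n : ℝ)⁻¹ • ∑ i, outerSelf (Z i - sampleMean Z)

/-- The NIW posterior of `(Σ, μ)` given `Z_1, …, Z_n` in the model `Z_i | μ, Σ ∼ N(μ, Σ)` i.i.d.
with prior `NIW(μ₀, l₀, Ψ₀, ν₀)`. -/
noncomputable def niwPosterior (μ₀ : EuclideanSpace ℝ (Fin K)) (l₀ : ℝ)
    (Ψ₀ : Matrix (Fin K) (Fin K) ℝ) (ν₀ : ℝ) {n : ℕ} (Z : Fin n → EuclideanSpace ℝ (Fin K)) :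
    Measure (Matrix (Fin K) (Fin K) ℝ × EuclideanSpace ℝ (Fin K)) :=
  normalInvWishart
    ((l₀ + n)⁻¹ • (l₀ • μ₀ + (n : ℝ) • sampleMean Z))
    (l₀ + n)
    (Ψ₀ + (n : ℝ) • sampleCov Z + (l₀ * n / (l₀ + n)) • outerSelf (sampleMean Z - μ₀))
    (ν₀ + n)

/-- The SLC score of model `k` for a posterior law `Q` of `(Σ, μ)`:
`Q(c*_δ(μ) = c(k)) * E_Q(exp(-α (μ_k - μ_{min,c(k)})))`. -/
noncomputable def slcScore (c : Fin K → ℝ≥0) (δ α : ℝ)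
    (Q : Measure (Matrix (Fin K) (Fin K) ℝ × EuclideanSpace ℝ (Fin K))) (k : Fin K) : ℝ :=
  Q.real {p | minComplexity c δ p.2 = c k} * ∫ p, softScore c α k p.2 ∂Q

end Posterior

/-! ### Losses, estimators and regularity conditions -/

section Losses

variable {𝒳 : Type*} [MeasurableSpace 𝒳]

/-- Expectation in the extended sense, `E(f⁺) - E(f⁻)`, with values in `[-∞, ∞]`. -/
noncomputable def extendedExpectation (P : Measure 𝒳) (f : 𝒳 → ℝ) : EReal :=
  ((∫⁻ x, ENNReal.ofReal (f x) ∂P : ℝ≥0∞) : EReal) -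
    ((∫⁻ x, ENNReal.ofReal (-f x) ∂P : ℝ≥0∞) : EReal)

/-- `argmin_{θ ∈ Θ} E(ℓ(X; θ))`. -/
def riskMinimizers (P : Measure 𝒳) {d : ℕ} (Θ : Set (EuclideanSpace ℝ (Fin d)))
    (ℓ : 𝒳 → EuclideanSpace ℝ (Fin d) → ℝ) : Set (EuclideanSpace ℝ (Fin d)) :=
  {θ | θ ∈ Θ ∧ IsMinOn (fun η => extendedExpectation P (fun x => ℓ x η)) Θ θ}

/-- `Y_n = O_p(a_n)`. -/
def IsBigOInProbability {Ω : Type*} [MeasurableSpace Ω] (prob : Measure Ω) (Y : ℕ → Ω → ℝ)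
    (a : ℕ → ℝ) : Prop :=
  ∀ ε : ℝ≥0∞, 0 < ε → ∃ M : ℝ, ∀ᶠ n in atTop, prob {ω | M * a n < |Y n ω|} ≤ ε

/-- The Hessian matrix of `f` at `θ`. -/
noncomputable def hessianMatrix {d : ℕ} (f : EuclideanSpace ℝ (Fin d) → ℝ)
    (θ : EuclideanSpace ℝ (Fin d)) : Matrix (Fin d) (Fin d) ℝ :=
  Matrix.of fun i j =>
    fderiv ℝ (fun η => fderiv ℝ f η (EuclideanSpace.single j 1)) θ (EuclideanSpace.single i 1)

/-- The Frobenius norm of a matrix. -/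
noncomputable def frobeniusNorm {d : ℕ} (A : Matrix (Fin d) (Fin d) ℝ) : ℝ :=
  √(∑ i, ∑ j, A i j ^ 2)

/-- The local regularity conditions on a single model with parameter set `Θ`, loss `ℓ` and risk
minimizer `θs`: integrability of the loss near `θs`, twice continuous differentiability near `θs`
with Hessian dominated by an integrable function, and square integrability of the gradient
at `θs`. -/
structure LossRegular (P : Measure 𝒳) {d : ℕ} (Θ : Set (EuclideanSpace ℝ (Fin d)))
    (ℓ : 𝒳 → EuclideanSpace ℝ (Fin d) → ℝ) (θs : EuclideanSpace ℝ (Fin d)) : Prop where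
  isOpen_param : IsOpen Θ
  measurable_loss : Measurable fun p : 𝒳 × Θ => ℓ p.1 p.2
  mem_riskMinimizers : θs ∈ riskMinimizers P Θ ℓ
  local_regularity : ∃ r : ℝ, 0 < r ∧ Metric.ball θs r ⊆ Θ ∧
    (∀ θ ∈ Metric.ball θs r, Integrable (fun x => ℓ x θ) P) ∧
    (∀ x, ContDiffOn ℝ 2 (ℓ x) (Metric.ball θs r)) ∧
    (∃ H : 𝒳 → ℝ, (∀ x, 0 ≤ H x) ∧ Integrable H P ∧
      ∀ x, ∀ θ ∈ Metric.ball θs r, frobeniusNorm (hessianMatrix (ℓ x) θ) ≤ H x)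
  gradient_sq_integrable : Integrable (fun x => ‖gradient (ℓ x) θs‖ ^ 2) P

variable {K : ℕ} {d : Fin K → ℕ}

/-- `μ⁰ = E(ℓ(X; θ*)) ∈ ℝ^K`. -/
noncomputable def trueMean (P : Measure 𝒳)
    (ℓ : (k : Fin K) → 𝒳 → EuclideanSpace ℝ (Fin (d k)) → ℝ)
    (θs : (k : Fin K) → EuclideanSpace ℝ (Fin (d k))) : EuclideanSpace ℝ (Fin K) :=
  WithLp.toLp 2 fun k => ∫ x, ℓ k x (θs k) ∂P

/-- `Σ⁰ = Cov(ℓ(X; θ*)) ∈ ℝ^{K × K}`. -/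
noncomputable def trueCov (P : Measure 𝒳)
    (ℓ : (k : Fin K) → 𝒳 → EuclideanSpace ℝ (Fin (d k)) → ℝ)
    (θs : (k : Fin K) → EuclideanSpace ℝ (Fin (d k))) : Matrix (Fin K) (Fin K) ℝ :=
  Matrix.of fun j k => covariance (fun x => ℓ j x (θs j)) (fun x => ℓ k x (θs k)) P

/-- The LaD vectors `Z_{ik} = ℓ_k(x_i; θ̂_k(x_1, …, x_n))`. -/
def ladVectors {n : ℕ} (ℓ : (k : Fin K) → 𝒳 → EuclideanSpace ℝ (Fin (d k)) → ℝ)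
    (θhat : (k : Fin K) → (Fin n → 𝒳) → EuclideanSpace ℝ (Fin (d k))) (x : Fin n → 𝒳) :
    Fin n → EuclideanSpace ℝ (Fin K) :=
  fun i => WithLp.toLp 2 fun k => ℓ k (x i) (θhat k x)

/-- The bias-corrected LaD vectors `Z_{ik} = ℓ_k(x_i; θ̂_k(x_1, …, x_n)) + d_k / (2n)`. -/
noncomputable def ladVectorsBC {n : ℕ} (ℓ : (k : Fin K) → 𝒳 → EuclideanSpace ℝ (Fin (d k)) → ℝ)
    (θhat : (k : Fin K) → (Fin n → 𝒳) → EuclideanSpace ℝ (Fin (d k))) (x : Fin n → 𝒳) :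
    Fin n → EuclideanSpace ℝ (Fin K) :=
  fun i => WithLp.toLp 2 fun k => ℓ k (x i) (θhat k x) + (d k : ℝ) / (2 * n)

end Losses

/-!
The posterior of `μ` concentrates at rate `1 / √n` around `μ⁰`, and the score is insensitive to
perturbations of that size because `α_n = o(√n)`. Only bounds of order `O_p(1 / √n)` are needed: no
central limit theorem, no exact moments of the inverse-Wishart law, and no first-order condition
at the risk minimizer.

*Posterior.* Write `e = (ν_n + K + 1) / 2`. For scale matrices `Ψ` with `a n ≤ Ψ` and entries at
most `b n`, the unnormalized inverse-Wishart density is at most `(C / (1 + ‖S‖)) ^ e` everywhere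
and at least `η ^ e` near the identity. Comparing the two integrals gives both a finite positive
normalizing constant and an exponentially small mass for `‖S‖` large, uniformly in `Ψ`
(`exists_invWishart_concentration`). Conditionally on a bounded `Σ`, the law `N(m, Σ / λ_n)` is the
image of a standard Gaussian under a map of norm `O(1 / √n)`
(`exists_normalInvWishart_concentration`). The matrix `Ψ_n` has the required order as soon as the
sample covariance is close to the positive definite `Σ⁰` (`exists_niwPosterior_concentration`).

*Data.* Two applications of the mean value inequality and the rate of `θ̂_k` show that the LaD
vectors differ from `ℓ_k(X_i; θ*_k)` by `O_p(1 / √n)` in mean square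
(`LossRegular.empMean_sq_sub_isBigO`); a shift by `d_k / (2n)` is of smaller order still.
Chebyshev's inequality and the law of large numbers then control the sample mean and the sample covariance
(`shiftedLadVectors_holdsInProbability`).

*Score.* As `δ` is not a gap of `μ⁰`, the minimal complexity is constant near `μ⁰`. The loss excess
inside a complexity class is Lipschitz in `μ`: multiplied by `α_n` it is negligible for the best
models, and tends to infinity for the others (`exists_eventually_abs_slcScore_sub_lt`).
-/

/-! ### Positive definite matrices: entries, determinants and traces -/

section PosDefBounds

variable {K : ℕ}

/-- The entries of a positive semidefinite matrix are dominated by its trace. -/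
theorem Matrix.PosSemidef.abs_apply_le_trace {W : Matrix (Fin K) (Fin K) ℝ} (hW : W.PosSemidef)
    (i j : Fin K) : |W i j| ≤ W.trace := by
  have hd : ∀ k, 0 ≤ W k k := fun k => hW.diag_nonneg
  have hle : ∀ k, W k k ≤ W.trace := fun k =>
    Finset.single_le_sum (f := fun k => W k k) (fun k _ => hd k) (Finset.mem_univ k)
  have hs : W j i = W i j := by simpa using hW.1.apply i j
  have h1 := hW.dotProduct_mulVec_nonneg (Pi.single i 1 + Pi.single j 1)
  have h2 := hW.dotProduct_mulVec_nonneg (Pi.single i 1 - Pi.single j 1)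
  simp only [star_trivial, mulVec_add, mulVec_sub, dotProduct_add, dotProduct_sub, add_dotProduct,
    sub_dotProduct, mulVec_single_one, single_one_dotProduct, Matrix.col_apply, hs] at h1 h2
  have := hle i
  have := hle j
  rw [abs_le]
  constructor <;> linarith

/-- If the quadratic form of `Ψ` dominates `a|x|²`, then `tr(ΨW) ≥ a tr W` for `W ≥ 0`. -/
theorem Matrix.PosSemidef.mul_trace_le_trace_mul {W Ψ : Matrix (Fin K) (Fin K) ℝ}
    (hW : W.PosSemidef) {a : ℝ} (hΨ : ∀ x : Fin K → ℝ, a * (x ⬝ᵥ x) ≤ x ⬝ᵥ (Ψ *ᵥ x)) :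
    a * W.trace ≤ (Ψ * W).trace := by
  obtain ⟨B, rfl⟩ := CStarAlgebra.nonneg_iff_eq_star_mul_self.mp hW.nonneg
  have h1 : (star B * B).trace = ∑ i, B i ⬝ᵥ B i := by
    rw [Matrix.trace_mul_comm]
    simp [Matrix.trace, Matrix.mul_apply, dotProduct, star_eq_conjTranspose]
  have h2 : (Ψ * (star B * B)).trace = ∑ i, B i ⬝ᵥ (Ψ *ᵥ B i) := by
    rw [← Matrix.mul_assoc, Matrix.trace_mul_comm]
    simp only [Matrix.trace, Matrix.diag_apply, Matrix.mul_apply, dotProduct,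
      star_eq_conjTranspose, conjTranspose_apply, star_trivial, mulVec]
  rw [h1, h2, Finset.mul_sum]
  exact Finset.sum_le_sum fun i _ => hΨ (B i)

/-- Leibniz bound for a determinant with real entries of absolute value at most `x`. -/
theorem Matrix.abs_det_le_factorial_mul_pow {A : Matrix (Fin K) (Fin K) ℝ} {x : ℝ}
    (h : ∀ i j, |A i j| ≤ x) : |A.det| ≤ K.factorial * x ^ K := by
  have := Matrix.det_le (abv := AbsoluteValue.abs) (A := A) (x := x) h
  simpa using this

/-- For a positive definite matrix `S` with inverse of trace `t`, both `1` and the entries of `S`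
are at most `det S · K! (1 + t) ^ K`: the first bounds `det S⁻¹`, the second the cofactors of
`S⁻¹`. -/
theorem Matrix.PosDef.le_det_mul {S : Matrix (Fin K) (Fin K) ℝ} (hS : S.PosDef) :
    1 ≤ S.det * (K.factorial * (1 + S⁻¹.trace) ^ K) ∧
      ∀ i j, |S i j| ≤ S.det * (K.factorial * (1 + S⁻¹.trace) ^ K) := by
  have hW := hS.inv.posSemidef
  have ht : 0 ≤ S⁻¹.trace := hW.trace_nonneg
  have hdet := hS.det_pos
  have hu : IsUnit S.det := hdet.ne'.isUnit
  have hent : ∀ i j, |S⁻¹ i j| ≤ 1 + S⁻¹.trace := fun i j =>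
    (hW.abs_apply_le_trace i j).trans (by linarith)
  constructor
  · have h := Matrix.abs_det_le_factorial_mul_pow hent
    have h1 : S.det * S⁻¹.det = 1 := by
      rw [← Matrix.det_mul, Matrix.mul_nonsing_inv _ hu, Matrix.det_one]
    calc (1 : ℝ) = S.det * S⁻¹.det := h1.symm
      _ ≤ _ := by gcongr; exact (le_abs_self _).trans h
  · intro i j
    have h1 : S = S.det • (S⁻¹).adjugate := by
      have h2 : (S⁻¹)⁻¹ = S := Matrix.nonsing_inv_nonsing_inv S hu
      conv_lhs => rw [← h2, Matrix.inv_def]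
      rw [Matrix.det_nonsing_inv, Ring.inverse_inverse hu]
    have h3 : |S i j| = S.det * |(S⁻¹).adjugate i j| := by
      conv_lhs => rw [h1]
      rw [Matrix.smul_apply, smul_eq_mul, abs_mul, abs_of_pos hdet]
    rw [h3]
    gcongr
    rw [Matrix.adjugate_apply]
    refine Matrix.abs_det_le_factorial_mul_pow fun k l => ?_
    rw [Matrix.updateRow_apply]
    split_ifs
    · rw [Pi.single_apply]; split_ifs <;> simp <;> linarith
    · exact hent k l

/-- A matrix with entries of absolute value at most `τ` has quadratic form at most `τ K |x|²`. -/
theorem Matrix.abs_dotProduct_mulVec_le {A : Matrix (Fin K) (Fin K) ℝ} {τ : ℝ}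
    (h : ∀ i j, |A i j| ≤ τ) (x : Fin K → ℝ) : |x ⬝ᵥ (A *ᵥ x)| ≤ τ * K * (x ⬝ᵥ x) := by
  rcases isEmpty_or_nonempty (Fin K) with hK | ⟨⟨i₀⟩⟩
  · simp [dotProduct]
  have hτ : 0 ≤ τ := (abs_nonneg _).trans (h i₀ i₀)
  calc |x ⬝ᵥ (A *ᵥ x)| = |∑ i, ∑ j, x i * (A i j * x j)| := by
        simp [dotProduct, mulVec, Finset.mul_sum]
    _ ≤ ∑ i, ∑ j, |x i * (A i j * x j)| :=
        (Finset.abs_sum_le_sum_abs _ _).trans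
          (Finset.sum_le_sum fun i _ => Finset.abs_sum_le_sum_abs _ _)
    _ ≤ ∑ i, ∑ j, τ * (|x i| * |x j|) := by
        refine Finset.sum_le_sum fun i _ => Finset.sum_le_sum fun j _ => ?_
        rw [abs_mul, abs_mul]
        nlinarith [mul_le_mul_of_nonneg_right (h i j) (mul_nonneg (abs_nonneg (x i))
          (abs_nonneg (x j)))]
    _ = τ * (∑ i, |x i|) ^ 2 := by
        rw [sq, Finset.sum_mul_sum, Finset.mul_sum]
        simp_rw [Finset.mul_sum]
    _ ≤ τ * (K * ∑ i, |x i| ^ 2) := by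
        gcongr
        simpa using sq_sum_le_card_mul_sum_sq (s := Finset.univ) (f := fun i => |x i|)
    _ = τ * K * (x ⬝ᵥ x) := by
        simp only [sq_abs, dotProduct, ← sq, mul_assoc]

/-- A symmetric matrix whose entries are close to those of the identity is positive definite. -/
theorem Matrix.posDef_of_abs_sub_one_le {S : Matrix (Fin K) (Fin K) ℝ} (hS : S.IsHermitian)
    (h : ∀ i j, |(S - 1) i j| ≤ 1 / (2 * K)) : S.PosDef := by
  refine Matrix.PosDef.of_dotProduct_mulVec_pos hS fun x hx => ?_
  have hK : (0 : ℝ) < K := by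
    rcases Nat.eq_zero_or_pos K with rfl | hK
    · exact absurd (Subsingleton.elim x 0) hx
    · exact_mod_cast hK
  have hpos : 0 < x ⬝ᵥ x := by simpa using dotProduct_star_self_pos_iff.2 hx
  have h1 := abs_le.1 (Matrix.abs_dotProduct_mulVec_le h x)
  have h2 : x ⬝ᵥ (S *ᵥ x) = x ⬝ᵥ ((S - 1) *ᵥ x) + x ⬝ᵥ x := by
    simp [sub_mulVec, dotProduct_sub]
  have h3 : 1 / (2 * (K : ℝ)) * K = 1 / 2 := by field_simp
  rw [h3] at h1
  rw [star_trivial, h2]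
  linarith [h1.1]

end PosDefBounds

/-! ### Uniform tail bounds for inverse-Wishart laws -/

section InverseWishartTail

variable {K : ℕ}

/-- The set of positive definite matrices is measurable. -/
theorem measurableSet_posDef : MeasurableSet {S : Matrix (Fin K) (Fin K) ℝ | S.PosDef} := by
  have h : {S : Matrix (Fin K) (Fin K) ℝ | S.PosDef} =
      ({S | Sᴴ = S} ∩ ⋂ x : Fin K → ℝ, {S | 0 ≤ star x ⬝ᵥ (S *ᵥ x)}) ∩ {S | S.det = 0}ᶜ := by
    ext S
    simp only [Set.mem_ofPred_eq, Set.mem_inter_iff, Set.mem_iInter, Set.mem_compl_iff]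
    constructor
    · exact fun hS => ⟨⟨hS.1, fun x => hS.posSemidef.dotProduct_mulVec_nonneg x⟩, hS.det_pos.ne'⟩
    · rintro ⟨⟨h1, h2⟩, h3⟩
      exact (Matrix.PosSemidef.of_dotProduct_mulVec_nonneg h1 h2).posDef_iff_det_ne_zero.2 h3
  rw [h]
  refine MeasurableSet.inter (IsClosed.measurableSet ?_) (IsClosed.measurableSet ?_).compl
  · refine (isClosed_eq (by fun_prop) continuous_id).inter (isClosed_iInter fun x => ?_)
    exact isClosed_le continuous_const (by fun_prop)
  · exact isClosed_eq (by fun_prop) continuous_const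

/-- The symmetric matrix with coordinates `v`: the parametrization that defines `symLebesgue`. -/
def symMatrix (v : Sym2 (Fin K) → ℝ) : Matrix (Fin K) (Fin K) ℝ :=
  Matrix.of fun i j => v s(i, j)

theorem continuous_symMatrix : Continuous (symMatrix (K := K)) := by
  unfold symMatrix
  exact continuous_matrix fun i j => continuous_apply _

theorem isHermitian_symMatrix (v : Sym2 (Fin K) → ℝ) : (symMatrix v).IsHermitian := by
  ext i j
  simp [symMatrix, Sym2.eq_swap]

theorem norm_le_of_abs_symMatrix_le {v : Sym2 (Fin K) → ℝ} {B : ℝ} (hB : 0 ≤ B)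
    (h : ∀ i j, |symMatrix v i j| ≤ B) : ‖v‖ ≤ B := by
  refine (pi_norm_le_iff_of_nonneg hB).2 fun e => ?_
  induction e with
  | _ i j => exact h i j

theorem abs_symMatrix_le_norm (v : Sym2 (Fin K) → ℝ) (i j : Fin K) : |symMatrix v i j| ≤ ‖v‖ :=
  norm_le_pi_norm v s(i, j)

/-- The exponential factor beats the polynomial losses in `Matrix.PosDef.le_det_mul`, so the
inverse determinant decays in all directions at the rate of the inverse norm. -/
theorem exists_inv_det_mul_exp_le (K : ℕ) {a : ℝ} (ha : 0 < a) :
    ∃ C : ℝ, 0 < C ∧ ∀ v : Sym2 (Fin K) → ℝ, (symMatrix v).PosDef →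
      (symMatrix v).det⁻¹ * Real.exp (-a * (symMatrix v)⁻¹.trace) ≤ C / (1 + ‖v‖) := by
  obtain ⟨B, hB⟩ : ∃ B : ℝ, ∀ t : ℝ, 0 ≤ t → (1 + t) ^ K * Real.exp (-a * t) ≤ B := by
    -- from `y ^ K / K! ≤ exp y` at `y = a (1 + t)`
    refine ⟨(1 / a) ^ K * K.factorial * Real.exp a, fun t ht => ?_⟩
    have h1 := Real.pow_div_factorial_le_exp (a * (1 + t)) (by positivity) K
    have h2 : (1 + t) ^ K = (1 / a) ^ K * K.factorial * ((a * (1 + t)) ^ K / K.factorial) := by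
      have : (K.factorial : ℝ) ≠ 0 := by positivity
      rw [mul_pow, one_div, inv_pow]
      field_simp
    rw [h2, mul_assoc _ (_ / _), mul_assoc ((1 / a) ^ K) _ (Real.exp a),
      mul_assoc ((1 / a) ^ K)]
    gcongr
    calc _ ≤ Real.exp (a * (1 + t)) * Real.exp (-a * t) := by gcongr
      _ = Real.exp a := by rw [← Real.exp_add]; ring_nf
  have hB0 : 0 < B := lt_of_lt_of_le (by simp) (hB 0 le_rfl)
  refine ⟨2 * (K.factorial * B), by positivity, fun v hv => ?_⟩
  obtain ⟨h1, h2⟩ := hv.le_det_mul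
  set S := symMatrix v
  set t := S⁻¹.trace
  have hd := hv.det_pos
  have ht : 0 ≤ t := hv.inv.posSemidef.trace_nonneg
  have h3 : ‖v‖ ≤ S.det * (K.factorial * (1 + t) ^ K) :=
    norm_le_of_abs_symMatrix_le (by positivity) h2
  rw [le_div_iff₀ (by positivity)]
  calc S.det⁻¹ * Real.exp (-a * t) * (1 + ‖v‖)
      ≤ S.det⁻¹ * Real.exp (-a * t) * (2 * (S.det * (K.factorial * (1 + t) ^ K))) := by
        gcongr; linarith
    _ = 2 * (K.factorial * ((1 + t) ^ K * Real.exp (-a * t))) := by field_simp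
    _ ≤ _ := by gcongr; exact hB t ht

/-- The exponent `(ν + K + 1) / 2` of the determinant in the inverse-Wishart density. -/
noncomputable def invWishartExponent (K : ℕ) (ν : ℝ) : ℝ := (ν + K + 1) / 2

theorem invWishartKernelDensity_of_posDef {S Ψ : Matrix (Fin K) (Fin K) ℝ} (hS : S.PosDef)
    (ν : ℝ) : invWishartKernelDensity Ψ ν S = ENNReal.ofReal
      (S.det⁻¹ ^ invWishartExponent K ν * Real.exp (-(Ψ * S⁻¹).trace / 2)) := by
  rw [invWishartKernelDensity, Set.indicator_of_mem (by exact hS), Real.inv_rpow hS.det_pos.le,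
    ← Real.rpow_neg hS.det_pos.le, invWishartExponent, neg_div]

/-- Domination of the inverse-Wishart density when the scale matrix `Ψ` is bounded below
proportionally to the exponent `e`. -/
theorem invWishartKernelDensity_le {a C : ℝ}
    (hC : ∀ v : Sym2 (Fin K) → ℝ, (symMatrix v).PosDef →
      (symMatrix v).det⁻¹ * Real.exp (-a * (symMatrix v)⁻¹.trace) ≤ C / (1 + ‖v‖))
    {ν : ℝ} (hν : 0 ≤ invWishartExponent K ν) {Ψ : Matrix (Fin K) (Fin K) ℝ}
    (hΨ : ∀ x : Fin K → ℝ, 2 * a * invWishartExponent K ν * (x ⬝ᵥ x) ≤ x ⬝ᵥ (Ψ *ᵥ x))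
    (v : Sym2 (Fin K) → ℝ) :
    invWishartKernelDensity Ψ ν (symMatrix v) ≤
      ENNReal.ofReal ((C / (1 + ‖v‖)) ^ invWishartExponent K ν) := by
  by_cases hS : (symMatrix v).PosDef
  · rw [invWishartKernelDensity_of_posDef hS]
    refine ENNReal.ofReal_le_ofReal ?_
    have hd := inv_pos.2 hS.det_pos
    have h1 := hS.inv.posSemidef.mul_trace_le_trace_mul hΨ
    calc _ ≤ (symMatrix v).det⁻¹ ^ invWishartExponent K ν *
          Real.exp (-a * (symMatrix v)⁻¹.trace) ^ invWishartExponent K ν := by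
          rw [← Real.exp_mul]
          gcongr
          linarith
      _ = ((symMatrix v).det⁻¹ * Real.exp (-a * (symMatrix v)⁻¹.trace)) ^
            invWishartExponent K ν := by
          rw [Real.mul_rpow hd.le (Real.exp_pos _).le]
      _ ≤ _ := by
          gcongr
          exact hC v hS
  · rw [invWishartKernelDensity, Set.indicator_of_notMem (by exact hS)]
    exact zero_le

/-- Near the identity the inverse-Wishart density is bounded below by the power `η ^ e` of a
constant when the entries of `Ψ` are at most proportional to the exponent `e`. -/
theorem exists_le_invWishartKernelDensity (K : ℕ) {b : ℝ} (hb : 0 ≤ b) :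
    ∃ η : ℝ, 0 < η ∧ ∃ V : Set (Sym2 (Fin K) → ℝ), IsOpen V ∧ V.Nonempty ∧
      ∀ v ∈ V, ∀ ν, 0 ≤ invWishartExponent K ν → ∀ Ψ : Matrix (Fin K) (Fin K) ℝ,
        (∀ i j, |Ψ i j| ≤ 2 * b * invWishartExponent K ν) →
        ENNReal.ofReal (η ^ invWishartExponent K ν) ≤
          invWishartKernelDensity Ψ ν (symMatrix v) := by
  -- the coordinates of the identity matrix
  set v₁ : Sym2 (Fin K) → ℝ := fun e => open Classical in if e.IsDiag then 1 else 0 with hv₁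
  have hv1 : symMatrix v₁ = 1 := by
    ext i j
    simp [symMatrix, hv₁, Matrix.one_apply]
  have hcont : Continuous fun v : Sym2 (Fin K) → ℝ => symMatrix v := continuous_symMatrix
  have h1 : ∀ᶠ v in 𝓝 v₁, ∀ i j, |(symMatrix v - 1) i j| ≤ 1 / (2 * (K : ℝ)) := by
    refine eventually_all.2 fun i => eventually_all.2 fun j => ?_
    have hK : (0 : ℝ) < 1 / (2 * K) := by
      have : (0 : ℝ) < K := by exact_mod_cast i.pos
      positivity
    have hc : Continuous fun v : Sym2 (Fin K) → ℝ => |(symMatrix v - 1) i j| :=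
      ((hcont.sub continuous_const).matrix_elem i j).abs
    have := hc.continuousAt (x := v₁)
    rw [ContinuousAt, hv1] at this
    simp only [sub_self, Matrix.zero_apply, abs_zero] at this
    exact (this.eventually (gt_mem_nhds hK)).mono fun v hv => hv.le
  have hdet : ContinuousAt (fun v : Sym2 (Fin K) → ℝ => (symMatrix v).det) v₁ :=
    hcont.matrix_det.continuousAt
  have h2 : ∀ᶠ v in 𝓝 v₁, (symMatrix v).det < 2 := by
    refine hdet.eventually (gt_mem_nhds ?_)
    simp only [hv1, Matrix.det_one]; norm_num
  have h3 : ∀ᶠ v in 𝓝 v₁, ∑ i, ∑ j, |(symMatrix v)⁻¹ i j| < K + 1 := by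
    have hc : ContinuousAt (fun v : Sym2 (Fin K) → ℝ => ∑ i, ∑ j, |(symMatrix v)⁻¹ i j|) v₁ := by
      refine tendsto_finsetSum _ fun i _ => tendsto_finsetSum _ fun j _ => Tendsto.abs ?_
      simp only [Matrix.inv_def, Ring.inverse_eq_inv', Matrix.smul_apply, smul_eq_mul]
      refine Tendsto.mul (hdet.inv₀ ?_) (hcont.matrix_adjugate.matrix_elem i j).continuousAt
      rw [hv1, Matrix.det_one]; norm_num
    refine hc.eventually (gt_mem_nhds ?_)
    simp only [hv1, inv_one]
    simp [Matrix.one_apply, apply_ite abs]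
  obtain ⟨V, hV, hVo, hv₁V⟩ := _root_.mem_nhds_iff.1 (h1.and (h2.and h3))
  refine ⟨2⁻¹ * Real.exp (-(b * (K + 1))), by positivity, V, hVo, ⟨v₁, hv₁V⟩, ?_⟩
  intro v hv ν hν Ψ hΨ
  obtain ⟨hv1, hv2, hv3⟩ := hV hv
  have hS := Matrix.posDef_of_abs_sub_one_le (isHermitian_symMatrix v) hv1
  rw [invWishartKernelDensity_of_posDef hS]
  set e := invWishartExponent K ν
  refine ENNReal.ofReal_le_ofReal ?_
  have htr : (Ψ * (symMatrix v)⁻¹).trace ≤ 2 * b * e * (K + 1) := by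
    calc (Ψ * (symMatrix v)⁻¹).trace = ∑ i, ∑ j, Ψ i j * (symMatrix v)⁻¹ j i := by
          simp [Matrix.trace, Matrix.mul_apply]
      _ ≤ ∑ i, ∑ j, 2 * b * e * |(symMatrix v)⁻¹ j i| := by
          refine Finset.sum_le_sum fun i _ => Finset.sum_le_sum fun j _ => ?_
          refine (le_abs_self _).trans ?_
          rw [abs_mul]
          gcongr
          exact hΨ i j
      _ = 2 * b * e * ∑ i, ∑ j, |(symMatrix v)⁻¹ i j| := by
          rw [Finset.sum_comm]
          simp_rw [Finset.mul_sum]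
      _ ≤ _ := by gcongr
  rw [Real.mul_rpow (by norm_num) (Real.exp_pos _).le, ← Real.exp_mul]
  have hdet' : 0 < (symMatrix v).det := hS.det_pos
  gcongr
  linarith

theorem measurable_invWishartKernelDensity (Ψ : Matrix (Fin K) (Fin K) ℝ) (ν : ℝ) :
    Measurable (invWishartKernelDensity Ψ ν) := by
  refine Measurable.indicator ?_ measurableSet_posDef
  have hdet : Measurable fun S : Matrix (Fin K) (Fin K) ℝ => S.det :=
    (continuous_id.matrix_det).measurable
  have hinv : ∀ i j, Measurable fun S : Matrix (Fin K) (Fin K) ℝ => S⁻¹ i j := fun i j => by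
    simp only [Matrix.inv_def, Ring.inverse_eq_inv', Matrix.smul_apply, smul_eq_mul]
    exact hdet.inv.mul (continuous_id.matrix_adjugate.matrix_elem i j).measurable
  have htr : Measurable fun S : Matrix (Fin K) (Fin K) ℝ => (Ψ * S⁻¹).trace := by
    simp only [Matrix.trace, Matrix.diag_apply, Matrix.mul_apply]
    exact Finset.measurable_sum _ fun i _ => Finset.measurable_sum _ fun j _ =>
      (hinv j i).const_mul _
  exact ((hdet.pow_const _).mul (htr.neg.div_const 2).exp).ennreal_ofReal

theorem invWishartUnnormalized_apply (Ψ : Matrix (Fin K) (Fin K) ℝ) (ν : ℝ)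
    {B : Set (Matrix (Fin K) (Fin K) ℝ)} (hB : MeasurableSet B) :
    invWishartUnnormalized Ψ ν B =
      ∫⁻ v in symMatrix ⁻¹' B, invWishartKernelDensity Ψ ν (symMatrix v) := by
  rw [invWishartUnnormalized, withDensity_apply _ hB]
  exact setLIntegral_map hB (measurable_invWishartKernelDensity Ψ ν)
    continuous_symMatrix.measurable

/-- Uniform concentration of inverse-Wishart laws as the degrees of freedom grow, for scale
matrices of the order of the degrees of freedom: they are probability measures, and all but a
small fraction of the mass sits on positive definite matrices with entries at most `R`. Laplace's
method: the density is at most `(C / (1 + ‖S‖)) ^ e` everywhere and at least `η ^ e` near the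
identity, so the region `1 + ‖S‖ > 2 C / η` carries a fraction of order `2 ^ (-e)`. -/
theorem exists_invWishart_concentration (K : ℕ) {a b : ℝ} (ha : 0 < a) (hb : 0 ≤ b) :
    ∃ R : ℝ, 0 < R ∧ ∀ ε : ℝ≥0∞, 0 < ε → ∃ E : ℝ, ∀ ν : ℝ, E ≤ invWishartExponent K ν →
      ∀ Ψ : Matrix (Fin K) (Fin K) ℝ,
        (∀ x : Fin K → ℝ, 2 * a * invWishartExponent K ν * (x ⬝ᵥ x) ≤ x ⬝ᵥ (Ψ *ᵥ x)) →
        (∀ i j, |Ψ i j| ≤ 2 * b * invWishartExponent K ν) →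
        IsProbabilityMeasure (invWishart Ψ ν) ∧
          invWishart Ψ ν {S | S.PosDef ∧ ∀ i j, |S i j| ≤ R}ᶜ ≤ ε := by
  obtain ⟨C, hC0, hC⟩ := exists_inv_det_mul_exp_le K ha
  obtain ⟨η, hη, V, hVo, hVne, hV⟩ := exists_le_invWishartKernelDensity K hb
  set r : ℝ := (Module.finrank ℝ (Sym2 (Fin K) → ℝ) : ℝ) + 1 with hr
  have hr0 : 0 < r := by positivity
  set I : ℝ≥0∞ := ∫⁻ v : Sym2 (Fin K) → ℝ, ENNReal.ofReal ((1 + ‖v‖) ^ (-r)) with hI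
  have hIfin : I < ∞ := finite_integral_one_add_norm (by rw [hr]; linarith)
  have hVpos : 0 < volume V := hVo.measure_pos volume hVne
  -- domination on the region `ρ ≤ 1 + ‖v‖`
  have hdom : ∀ ρ : ℝ, 0 < ρ → ∀ ν : ℝ, r ≤ invWishartExponent K ν →
      ∀ Ψ : Matrix (Fin K) (Fin K) ℝ,
      (∀ x : Fin K → ℝ, 2 * a * invWishartExponent K ν * (x ⬝ᵥ x) ≤ x ⬝ᵥ (Ψ *ᵥ x)) →
      ∀ B : Set (Matrix (Fin K) (Fin K) ℝ), MeasurableSet B →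
      (∀ v, symMatrix v ∈ B → ρ ≤ 1 + ‖v‖) → invWishartUnnormalized Ψ ν B ≤
        ENNReal.ofReal ((C / ρ) ^ (invWishartExponent K ν - r) * C ^ r) * I := by
    intro ρ hρ ν hν Ψ hΨ B hB hBρ
    rw [invWishartUnnormalized_apply Ψ ν hB, hI, ← lintegral_const_mul' _ _ ENNReal.ofReal_ne_top]
    refine (setLIntegral_mono' (continuous_symMatrix.measurable hB) fun v hv => ?_).trans
      (setLIntegral_le_lintegral _ _)
    refine (invWishartKernelDensity_le hC (hr0.le.trans hν) hΨ v).trans ?_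
    rw [← ENNReal.ofReal_mul (by positivity)]
    refine ENNReal.ofReal_le_ofReal ?_
    have hv0 : 0 < 1 + ‖v‖ := by positivity
    calc (C / (1 + ‖v‖)) ^ invWishartExponent K ν
        = (C / (1 + ‖v‖)) ^ (invWishartExponent K ν - r) * (C / (1 + ‖v‖)) ^ r := by
          rw [← Real.rpow_add (by positivity)]; ring_nf
      _ ≤ (C / ρ) ^ (invWishartExponent K ν - r) * (C / (1 + ‖v‖)) ^ r := by
          have : 0 ≤ invWishartExponent K ν - r := by linarith
          gcongr
          exact hBρ v hv
      _ = _ := by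
          rw [Real.div_rpow hC0.le hv0.le, Real.rpow_neg hv0.le]
          ring
  refine ⟨2 * C / η, by positivity, fun ε hε => ?_⟩
  set c₀ : ℝ≥0∞ := ENNReal.ofReal ((C / η) ^ r) * I / volume V with hc₀
  have hlim : Tendsto (fun e : ℝ => ENNReal.ofReal (2⁻¹ ^ (e - r)) * c₀) atTop (𝓝 0) := by
    have h1 : Tendsto (fun e : ℝ => (2⁻¹ : ℝ) ^ (e - r)) atTop (𝓝 0) :=
      (tendsto_rpow_atTop_of_base_lt_one _ (by norm_num) (by norm_num)).comp
        (tendsto_atTop_add_const_right _ _ tendsto_id)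
    have h2 := ENNReal.tendsto_ofReal h1
    rw [ENNReal.ofReal_zero] at h2
    have h3 : c₀ ≠ ∞ := (ENNReal.div_lt_top
      (ENNReal.mul_lt_top ENNReal.ofReal_lt_top hIfin).ne hVpos.ne').ne
    simpa using ENNReal.Tendsto.mul_const h2 (Or.inr h3)
  obtain ⟨E, hE⟩ := eventually_atTop.1 (hlim.eventually (ge_mem_nhds hε))
  refine ⟨max E r, fun ν hν Ψ hΨl hΨu => ?_⟩
  set e := invWishartExponent K ν with he
  have hEe : E ≤ e := (le_max_left _ _).trans hν
  have hre : r ≤ e := (le_max_right _ _).trans hν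
  -- mass of a neighbourhood of the identity
  have hlow : ENNReal.ofReal (η ^ e) * volume V ≤ invWishartUnnormalized Ψ ν Set.univ := by
    rw [invWishartUnnormalized_apply Ψ ν MeasurableSet.univ, Set.preimage_univ,
      Measure.restrict_univ]
    calc _ = ∫⁻ v in V, ENNReal.ofReal (η ^ e) := by simp
      _ ≤ ∫⁻ v in V, invWishartKernelDensity Ψ ν (symMatrix v) :=
          setLIntegral_mono' hVo.measurableSet fun v hv =>
            hV v hv ν (hr0.le.trans hre) Ψ hΨu
      _ ≤ _ := setLIntegral_le_lintegral _ _
  have hpos : invWishartUnnormalized Ψ ν Set.univ ≠ 0 := by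
    refine (lt_of_lt_of_le (ENNReal.mul_pos ?_ hVpos.ne') hlow).ne'
    simpa using Real.rpow_pos_of_pos hη e
  have hfin : invWishartUnnormalized Ψ ν Set.univ ≠ ∞ :=
    ((hdom 1 one_pos ν hre Ψ hΨl _ MeasurableSet.univ fun v _ => by simp).trans_lt
      (ENNReal.mul_lt_top ENNReal.ofReal_lt_top hIfin)).ne
  refine ⟨⟨by rw [invWishart, Measure.smul_apply, smul_eq_mul, ENNReal.inv_mul_cancel hpos hfin]⟩,
    ?_⟩
  set B : Set (Matrix (Fin K) (Fin K) ℝ) := {S | ∀ i j, |S i j| ≤ 2 * C / η}ᶜ with hBdef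
  have hBm : MeasurableSet B := by
    refine (IsClosed.measurableSet ?_).compl
    simp only [Set.ofPred_forall]
    exact isClosed_iInter fun i => isClosed_iInter fun j =>
      isClosed_le (continuous_id.matrix_elem i j).abs continuous_const
  have hPD : invWishartUnnormalized Ψ ν {S | S.PosDef}ᶜ = 0 := by
    rw [invWishartUnnormalized, withDensity_apply _ measurableSet_posDef.compl,
      setLIntegral_congr_fun measurableSet_posDef.compl (g := fun _ => 0)]
    · simp
    · exact fun S hS => Set.indicator_of_notMem hS _
  have hBρ : ∀ v, symMatrix v ∈ B → 2 * C / η ≤ 1 + ‖v‖ := by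
    intro v hv
    by_contra hlt
    exact hv fun i j => (abs_symMatrix_le_norm v i j).trans (by linarith)
  have hB : invWishartUnnormalized Ψ ν B ≤
      ENNReal.ofReal ((2⁻¹ * η) ^ (e - r) * C ^ r) * I := by
    have := hdom (2 * C / η) (by positivity) ν hre Ψ hΨl B hBm hBρ
    rwa [show C / (2 * C / η) = 2⁻¹ * η by field_simp] at this
  have hsub : {S : Matrix (Fin K) (Fin K) ℝ | S.PosDef ∧ ∀ i j, |S i j| ≤ 2 * C / η}ᶜ ⊆
      {S | S.PosDef}ᶜ ∪ B := by
    intro S hS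
    by_cases h : S.PosDef
    · exact Or.inr fun h' => hS ⟨h, h'⟩
    · exact Or.inl h
  refine le_trans ?_ (hE e hEe)
  calc invWishart Ψ ν _ ≤ invWishart Ψ ν ({S | S.PosDef}ᶜ ∪ B) := measure_mono hsub
    _ ≤ invWishart Ψ ν {S | S.PosDef}ᶜ + invWishart Ψ ν B := measure_union_le _ _
    _ = (invWishartUnnormalized Ψ ν Set.univ)⁻¹ * invWishartUnnormalized Ψ ν B := by
        simp [invWishart, hPD]
    _ ≤ (ENNReal.ofReal (η ^ e) * volume V)⁻¹ *
          (ENNReal.ofReal ((2⁻¹ * η) ^ (e - r) * C ^ r) * I) := by gcongr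
    _ = ENNReal.ofReal (2⁻¹ ^ (e - r)) * c₀ := by
        have h1 : (2⁻¹ * η) ^ (e - r) * C ^ r = η ^ e * (2⁻¹ ^ (e - r) * (C / η) ^ r) := by
          rw [Real.mul_rpow (by norm_num) hη.le, Real.div_rpow hC0.le hη.le, Real.rpow_sub hη]
          field_simp
        have h2 : ENNReal.ofReal (η ^ e) ≠ 0 := by simpa using Real.rpow_pos_of_pos hη e
        rw [h1, ENNReal.ofReal_mul (by positivity), ENNReal.ofReal_mul (by positivity), hc₀,
          ENNReal.mul_inv (Or.inl h2) (Or.inl ENNReal.ofReal_ne_top), ENNReal.div_eq_inv_mul]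
        rw [show ∀ x y z w u i : ℝ≥0∞, x * y * (z * (w * u) * i) = x * z * (w * (y * (u * i))) from
          fun x y z w u i => by ring, ENNReal.inv_mul_cancel h2 ENNReal.ofReal_ne_top, one_mul]

end InverseWishartTail

/-! ### Concentration of Normal-Inverse-Wishart laws -/

section NIWConcentration

variable {K : ℕ}

theorem norm_sq_toEuclideanCLM_sqrt {S : Matrix (Fin K) (Fin K) ℝ} (hS : S.PosSemidef)
    (x : EuclideanSpace ℝ (Fin K)) :
    ‖toEuclideanCLM (𝕜 := ℝ) (CFC.sqrt S) x‖ ^ 2 = x.ofLp ⬝ᵥ (S *ᵥ x.ofLp) := by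
  have hsa : IsSelfAdjoint (toEuclideanCLM (𝕜 := ℝ) (n := Fin K) (CFC.sqrt S)) :=
    (CFC.sqrt_nonneg S).isSelfAdjoint.map _
  rw [← real_inner_self_eq_norm_sq, ← ContinuousLinearMap.adjoint_inner_right, hsa.adjoint_eq,
    ← ContinuousLinearMap.comp_apply, ← ContinuousLinearMap.mul_def, ← map_mul,
    CFC.sqrt_mul_sqrt_self _ hS.nonneg, inner_toEuclideanCLM]

theorem multivariateGaussian_norm_sub_gt_le {S : Matrix (Fin K) (Fin K) ℝ} (hS : S.PosSemidef)
    {R : ℝ} (hR : ∀ i j, |S i j| ≤ R) (m : EuclideanSpace ℝ (Fin K)) {t : ℝ} (ht : 0 ≤ t) :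
    multivariateGaussian m S {x | t < ‖x - m‖} ≤
      stdGaussian (EuclideanSpace ℝ (Fin K)) {x | t ^ 2 < R * K * ‖x‖ ^ 2} := by
  rw [multivariateGaussian, Measure.map_apply (by fun_prop)
    (measurableSet_lt measurable_const (by fun_prop))]
  refine measure_mono fun x hx => ?_
  simp only [Set.mem_preimage, Set.mem_ofPred_eq, add_sub_cancel_left] at hx ⊢
  calc t ^ 2 < ‖toEuclideanCLM (𝕜 := ℝ) (CFC.sqrt S) x‖ ^ 2 := by gcongr
    _ = x.ofLp ⬝ᵥ (S *ᵥ x.ofLp) := norm_sq_toEuclideanCLM_sqrt hS x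
    _ ≤ R * K * (x.ofLp ⬝ᵥ x.ofLp) := (le_abs_self _).trans (abs_dotProduct_mulVec_le hR _)
    _ = R * K * ‖x‖ ^ 2 := by
        rw [EuclideanSpace.real_norm_sq_eq]; simp [dotProduct, sq]

theorem exists_measure_norm_gt_le {E : Type*} [NormedAddCommGroup E] [MeasurableSpace E]
    [BorelSpace E] (μ : Measure E) [IsFiniteMeasure μ] {ε : ℝ≥0∞} (hε : 0 < ε) :
    ∃ M : ℝ, 0 < M ∧ μ {x | M < ‖x‖} ≤ ε := by
  have h : Tendsto (fun n : ℕ => μ {x | (n : ℝ) < ‖x‖}) atTop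
      (𝓝 (μ (⋂ n : ℕ, {x | (n : ℝ) < ‖x‖}))) := by
    refine tendsto_measure_iInter_atTop
      (fun n => (measurableSet_lt measurable_const measurable_norm).nullMeasurableSet) ?_
      ⟨0, measure_ne_top _ _⟩
    intro m n hmn x (hx : (n : ℝ) < ‖x‖)
    exact lt_of_le_of_lt (Nat.cast_le.2 hmn) hx
  have he : (⋂ n : ℕ, {x : E | (n : ℝ) < ‖x‖}) = ∅ := by
    refine Set.eq_empty_of_forall_notMem fun x hx => ?_
    obtain ⟨n, hn⟩ := exists_nat_ge ‖x‖
    exact absurd (Set.mem_iInter.1 hx n) (not_lt.2 hn)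
  rw [he, measure_empty] at h
  obtain ⟨n, hn, hn0⟩ := ((h.eventually (ge_mem_nhds hε)).and (eventually_gt_atTop 0)).exists
  exact ⟨n, by exact_mod_cast hn0, hn⟩

/-- Uniform root-`n` concentration of the mean component of Normal-Inverse-Wishart laws around
its location parameter, for scale matrices of the order of the degrees of freedom. -/
theorem exists_normalInvWishart_concentration (K : ℕ) {a b : ℝ} (ha : 0 < a) (hb : 0 ≤ b)
    {ε : ℝ≥0∞} (hε : 0 < ε) :
    ∃ M : ℝ, 0 < M ∧ ∃ E : ℝ, ∀ ν : ℝ, E ≤ invWishartExponent K ν →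
      ∀ Ψ : Matrix (Fin K) (Fin K) ℝ,
        (∀ x : Fin K → ℝ, 2 * a * invWishartExponent K ν * (x ⬝ᵥ x) ≤ x ⬝ᵥ (Ψ *ᵥ x)) →
        (∀ i j, |Ψ i j| ≤ 2 * b * invWishartExponent K ν) →
        ∀ (m : EuclideanSpace ℝ (Fin K)) (l : ℝ), 0 < l →
        IsProbabilityMeasure (normalInvWishart m l Ψ ν) ∧
          normalInvWishart m l Ψ ν {p | M / √l < ‖p.2 - m‖} ≤ ε := by
  obtain ⟨R, hR, hIW⟩ := exists_invWishart_concentration K ha hb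
  have hε2 : 0 < ε / 2 := ENNReal.half_pos hε.ne'
  obtain ⟨E, hE⟩ := hIW (ε / 2) hε2
  obtain ⟨M, hM, hMε⟩ :=
    exists_measure_norm_gt_le (stdGaussian (EuclideanSpace ℝ (Fin K))) hε2
  refine ⟨√(R * (K + 1)) * M, by positivity, E, fun ν hν Ψ h1 h2 m l hl => ?_⟩
  obtain ⟨hprob, hbad⟩ := hE ν hν Ψ h1 h2
  refine ⟨by unfold normalInvWishart; infer_instance, ?_⟩
  set G : Set (Matrix (Fin K) (Fin K) ℝ) := {S | S.PosDef ∧ ∀ i j, |S i j| ≤ R} with hG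
  have hGm : MeasurableSet G := by
    refine measurableSet_posDef.inter
      (s₂ := {S : Matrix (Fin K) (Fin K) ℝ | ∀ i j, |S i j| ≤ R}) (IsClosed.measurableSet ?_)
    simp only [Set.ofPred_forall]
    exact isClosed_iInter fun i => isClosed_iInter fun j =>
      isClosed_le (continuous_id.matrix_elem i j).abs continuous_const
  have hker : ∀ S ∈ G, gaussianMeanKernel m l S {x | √(R * (K + 1)) * M / √l < ‖x - m‖} ≤
      ε / 2 := by
    intro S hS
    have hlS : (l⁻¹ • S).PosSemidef := hS.1.posSemidef.smul (inv_pos.2 hl).le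
    have hlR : ∀ i j, |(l⁻¹ • S) i j| ≤ R / l := fun i j => by
      rw [Matrix.smul_apply, smul_eq_mul, abs_mul, abs_of_pos (inv_pos.2 hl), div_eq_inv_mul]
      gcongr
      exact hS.2 i j
    refine (multivariateGaussian_norm_sub_gt_le hlS hlR m (by positivity)).trans
      ((measure_mono fun x hx => ?_).trans hMε)
    simp only [Set.mem_ofPred_eq] at hx ⊢
    rw [div_pow, mul_pow, Real.sq_sqrt (by positivity), Real.sq_sqrt hl.le,
      div_mul_eq_mul_div, div_mul_eq_mul_div, div_lt_div_iff_of_pos_right hl] at hx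
    by_contra hlt
    have h3 : ‖x‖ ^ 2 ≤ M ^ 2 := by gcongr; exact not_lt.1 hlt
    have h4 : R * K * ‖x‖ ^ 2 ≤ R * (K + 1) * M ^ 2 := by gcongr; linarith
    linarith
  have hsm : MeasurableSet {p : Matrix (Fin K) (Fin K) ℝ × EuclideanSpace ℝ (Fin K) |
      √(R * (K + 1)) * M / √l < ‖p.2 - m‖} :=
    measurableSet_lt measurable_const (by fun_prop)
  rw [normalInvWishart, Measure.compProd_apply hsm, ← lintegral_add_compl _ hGm]
  calc _ ≤ ∫⁻ S in G, ε / 2 ∂invWishart Ψ ν + ∫⁻ S in Gᶜ, 1 ∂invWishart Ψ ν := by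
        refine add_le_add (setLIntegral_mono' hGm fun S hS => hker S hS)
          (lintegral_mono fun S => prob_le_one)
    _ ≤ ε / 2 * 1 + ε / 2 := by
        rw [setLIntegral_const, setLIntegral_const, one_mul]
        gcongr
        exact prob_le_one
    _ = ε := by rw [mul_one, ENNReal.add_halves]

end NIWConcentration

/-! ### Stability of model selection -/

section SelectionStability

variable {K : ℕ}

theorem abs_iInf_sub_iInf_le {ι : Type*} [Finite ι] [Nonempty ι] {f g : ι → ℝ} {t : ℝ}
    (h : ∀ i, |f i - g i| ≤ t) : |(⨅ i, f i) - ⨅ i, g i| ≤ t := by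
  have hf : BddBelow (Set.range f) := (Set.finite_range f).bddBelow
  have hg : BddBelow (Set.range g) := (Set.finite_range g).bddBelow
  rw [abs_sub_le_iff]
  constructor
  · rw [sub_le_comm]
    exact le_ciInf fun i => by linarith [ciInf_le hf i, (abs_sub_le_iff.1 (h i)).1]
  · rw [sub_le_comm]
    exact le_ciInf fun i => by linarith [ciInf_le hg i, (abs_sub_le_iff.1 (h i)).2]

theorem abs_apply_sub_le_norm (μ μ' : EuclideanSpace ℝ (Fin K)) (k : Fin K) :
    |μ k - μ' k| ≤ ‖μ - μ'‖ := PiLp.norm_apply_le (μ - μ') k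

/-- When `δ` is not one of the gaps of `μ⁰`, the set of `δ`-optimal models is locally constant
at `μ⁰`. -/
theorem exists_deltaOptimal_eq {δ : ℝ} {μ' : EuclideanSpace ℝ (Fin K)}
    (hgap : ∀ k, δ ≠ μ' k - ⨅ j, μ' j) :
    ∃ ρ : ℝ, 0 < ρ ∧ ∀ μ : EuclideanSpace ℝ (Fin K), ‖μ - μ'‖ ≤ ρ →
      deltaOptimal δ μ = deltaOptimal δ μ' := by
  have h : ∀ᶠ ρ in 𝓝[>] (0 : ℝ), ∀ k, 2 * ρ < |δ - (μ' k - ⨅ j, μ' j)| := by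
    refine eventually_all.2 fun k => ?_
    have hpos : 0 < |δ - (μ' k - ⨅ j, μ' j)| := abs_pos.2 (sub_ne_zero.2 (hgap k))
    have hc : Tendsto (fun ρ : ℝ => 2 * ρ) (𝓝[>] 0) (𝓝 (2 * 0)) :=
      ((continuous_const.mul continuous_id).tendsto 0).mono_left nhdsWithin_le_nhds
    exact hc.eventually (gt_mem_nhds (by simpa using hpos))
  obtain ⟨ρ, hρ, hρ0⟩ := (h.and self_mem_nhdsWithin).exists
  refine ⟨ρ, hρ0, fun μ hμ => ?_⟩
  ext k
  have : Nonempty (Fin K) := ⟨k⟩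
  have h1 := abs_sub_le_iff.1 ((abs_apply_sub_le_norm μ μ' k).trans hμ)
  have h2 := abs_sub_le_iff.1
    (abs_iInf_sub_iInf_le fun j => (abs_apply_sub_le_norm μ μ' j).trans hμ)
  have h3 := hρ k
  simp only [deltaOptimal, Set.mem_ofPred_eq]
  rcases lt_abs.1 h3 with h3 | h3
  · exact ⟨fun _ => by linarith, fun _ => by linarith [h1.1, h2.2]⟩
  · exact ⟨fun h4 => by linarith [h1.2, h2.1], fun h4 => by linarith⟩

variable (c : Fin K → ℝ≥0)

/-- Loss excess of model `k` over the best model of the same complexity. -/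
noncomputable def classExcess (k : Fin K) (μ : EuclideanSpace ℝ (Fin K)) : ℝ :=
  μ k - ⨅ j : {j : Fin K // c j = c k}, μ j

theorem softScore_eq (α : ℝ) (k : Fin K) (μ : EuclideanSpace ℝ (Fin K)) :
    softScore c α k μ = Real.exp (-α * classExcess c k μ) := rfl

theorem classExcess_nonneg (k : Fin K) (μ : EuclideanSpace ℝ (Fin K)) :
    0 ≤ classExcess c k μ :=
  sub_nonneg.2 (ciInf_le (Set.finite_range fun j : {j : Fin K // c j = c k} => μ j).bddBelow
    ⟨k, rfl⟩)

theorem abs_classExcess_sub_le (k : Fin K) (μ μ' : EuclideanSpace ℝ (Fin K)) :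
    |classExcess c k μ - classExcess c k μ'| ≤ 2 * ‖μ - μ'‖ := by
  have : Nonempty {j : Fin K // c j = c k} := ⟨⟨k, rfl⟩⟩
  have h1 := abs_sub_le_iff.1 (abs_apply_sub_le_norm μ μ' k)
  have h2 := abs_sub_le_iff.1 (abs_iInf_sub_iInf_le
    fun j : {j : Fin K // c j = c k} => abs_apply_sub_le_norm μ μ' j)
  unfold classExcess
  rw [abs_sub_le_iff]
  constructor <;> linarith [h1.1, h1.2, h2.1, h2.2]

theorem classExcess_eq_zero_iff (k : Fin K) (μ : EuclideanSpace ℝ (Fin K)) :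
    classExcess c k μ = 0 ↔ ∀ j, c j = c k → μ k ≤ μ j := by
  have : Nonempty {j : Fin K // c j = c k} := ⟨⟨k, rfl⟩⟩
  have hb := (Set.finite_range fun j : {j : Fin K // c j = c k} => μ j).bddBelow
  constructor
  · intro h j hj
    rw [classExcess, sub_eq_zero] at h
    rw [h]
    exact ciInf_le hb ⟨j, hj⟩
  · intro h
    exact le_antisymm (sub_nonpos.2 (le_ciInf fun j => h j j.2)) (classExcess_nonneg c k μ)

theorem measurable_classExcess (k : Fin K) : Measurable (classExcess c k) := by
  unfold classExcess
  have h : ∀ j, Measurable fun μ : EuclideanSpace ℝ (Fin K) => μ j := fun j => by fun_prop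
  exact (h k).sub (Measurable.iInf fun j => h j)

theorem softScore_nonneg (α : ℝ) (k : Fin K) (μ : EuclideanSpace ℝ (Fin K)) :
    0 ≤ softScore c α k μ := (Real.exp_pos _).le

theorem softScore_le_one {α : ℝ} (hα : 0 ≤ α) (k : Fin K) (μ : EuclideanSpace ℝ (Fin K)) :
    softScore c α k μ ≤ 1 := by
  rw [softScore_eq, Real.exp_le_one_iff, neg_mul]
  exact neg_nonpos.2 (mul_nonneg hα (classExcess_nonneg c k μ))

variable (Q : Measure (Matrix (Fin K) (Fin K) ℝ × EuclideanSpace ℝ (Fin K)))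

theorem integral_softScore_nonneg (α : ℝ) (k : Fin K) : 0 ≤ ∫ p, softScore c α k p.2 ∂Q :=
  integral_nonneg fun p => softScore_nonneg c α k p.2

variable [IsProbabilityMeasure Q]

theorem integrable_softScore {α : ℝ} (hα : 0 ≤ α) (k : Fin K) :
    Integrable (fun p => softScore c α k p.2) Q := by
  refine Integrable.of_bound (C := 1) ?_ (Eventually.of_forall fun p => ?_)
  · simp only [softScore_eq]
    exact (((measurable_classExcess c k).comp measurable_snd).const_mul
      (-α)).exp.aestronglyMeasurable
  · rw [Real.norm_of_nonneg (softScore_nonneg c α k p.2)]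
    exact softScore_le_one c hα k p.2

theorem integral_softScore_le_one {α : ℝ} (hα : 0 ≤ α) (k : Fin K) :
    ∫ p, softScore c α k p.2 ∂Q ≤ 1 := by
  have := integral_mono (integrable_softScore c Q hα k) (integrable_const 1)
    fun p => softScore_le_one c hα k p.2
  simpa using this

variable {c}

/-- Bounds on the expected soft score under a law of `μ` that puts mass at least `1 - η` on the
ball of radius `t` around `μ⁰`. -/
theorem integral_softScore_bounds {α : ℝ} (hα : 0 ≤ α) (k : Fin K)
    {μ' : EuclideanSpace ℝ (Fin K)} {t η : ℝ}
    (hQ : Q.real {p | t < ‖p.2 - μ'‖} ≤ η) :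
    Real.exp (-α * (classExcess c k μ' + 2 * t)) * (1 - η) ≤ ∫ p, softScore c α k p.2 ∂Q ∧
      ∫ p, softScore c α k p.2 ∂Q ≤ Real.exp (-α * (classExcess c k μ' - 2 * t)) + η := by
  set B : Set (Matrix (Fin K) (Fin K) ℝ × EuclideanSpace ℝ (Fin K)) := {p | t < ‖p.2 - μ'‖}
    with hB
  have hBm : MeasurableSet B := measurableSet_lt measurable_const (by fun_prop)
  have hint := integrable_softScore c Q hα k
  have hclose : ∀ p ∉ B, |classExcess c k p.2 - classExcess c k μ'| ≤ 2 * t := fun p hp =>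
    (abs_classExcess_sub_le c k p.2 μ').trans
      (by linarith [not_lt.1 (show ¬ t < ‖p.2 - μ'‖ from hp)])
  constructor
  · calc _ ≤ Real.exp (-α * (classExcess c k μ' + 2 * t)) * Q.real Bᶜ := by
          gcongr
          rw [probReal_compl_eq_one_sub hBm]
          linarith
      _ = ∫ p, Bᶜ.indicator (fun _ => Real.exp (-α * (classExcess c k μ' + 2 * t))) p ∂Q := by
          rw [integral_indicator_const _ hBm.compl, smul_eq_mul, mul_comm]
      _ ≤ _ := by
          refine integral_mono ((integrable_const _).indicator hBm.compl) hint fun p => ?_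
          by_cases hp : p ∈ B
          · simpa [hp] using softScore_nonneg c α k p.2
          · simp only [Set.indicator_of_mem (show p ∈ Bᶜ from hp), softScore_eq]
            have := (abs_sub_le_iff.1 (hclose p hp)).1
            rw [Real.exp_le_exp, neg_mul, neg_mul, neg_le_neg_iff]
            gcongr
            linarith
  · calc _ ≤ ∫ p, (Real.exp (-α * (classExcess c k μ' - 2 * t)) +
            B.indicator (fun _ => 1) p) ∂Q := by
          refine integral_mono hint
            ((integrable_const _).add ((integrable_const _).indicator hBm)) fun p => ?_
          by_cases hp : p ∈ B
          · simp only [Set.indicator_of_mem hp]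
            linarith [softScore_le_one c hα k p.2,
              Real.exp_pos (-α * (classExcess c k μ' - 2 * t))]
          · simp only [Set.indicator_of_notMem hp, softScore_eq, add_zero]
            have := (abs_sub_le_iff.1 (hclose p hp)).2
            rw [Real.exp_le_exp, neg_mul, neg_mul, neg_le_neg_iff]
            gcongr
            linarith
      _ = Real.exp (-α * (classExcess c k μ' - 2 * t)) + Q.real B := by
          rw [integral_add (integrable_const _) ((integrable_const _).indicator hBm),
            integral_indicator_const _ hBm]
          simp
      _ ≤ _ := by gcongr

end SelectionStability

/-- If the posterior of `μ` puts mass `1 - η` on a ball of radius `M / √n` around `μ⁰`, the score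
is close to the indicator of the best models at `μ⁰`. The condition `α_n = o(√n)` makes the soft
score insensitive to perturbations of order `1 / √n`, and `α_n → ∞` kills strictly suboptimal
models. -/
theorem exists_eventually_abs_slcScore_sub_lt {K : ℕ} (c : Fin K → ℝ≥0) {δ : ℝ}
    {μ' : EuclideanSpace ℝ (Fin K)} (hgap : ∀ k, δ ≠ μ' k - ⨅ j, μ' j)
    {α : ℕ → ℝ} (hα0 : ∀ n, 0 ≤ α n) (hαtop : Tendsto α atTop atTop)
    (hαo : α =o[atTop] fun n : ℕ => √(n : ℝ)) (k : Fin K) {ε : ℝ} (hε : 0 < ε) :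
    ∃ η : ℝ, 0 < η ∧ ∀ M : ℝ, ∀ᶠ n : ℕ in atTop,
      ∀ Q : Measure (Matrix (Fin K) (Fin K) ℝ × EuclideanSpace ℝ (Fin K)),
        IsProbabilityMeasure Q → Q {p | M / √(n : ℝ) < ‖p.2 - μ'‖} ≤ ENNReal.ofReal η →
        |slcScore c δ (α n) Q k - Set.indicator (bestModels c δ μ') 1 k| < ε := by
  obtain ⟨ρ, hρ, hstab⟩ := exists_deltaOptimal_eq hgap
  obtain ⟨η, hη, hη1, hηε⟩ : ∃ η : ℝ, 0 < η ∧ η ≤ 1 / 2 ∧ η ≤ ε / 4 :=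
    ⟨min (1 / 2) (ε / 4), by positivity, min_le_left _ _, min_le_right _ _⟩
  refine ⟨η, hη, fun M => ?_⟩
  have ht0 : Tendsto (fun n : ℕ => M / √(n : ℝ)) atTop (𝓝 0) :=
    (Real.tendsto_sqrt_atTop.comp tendsto_natCast_atTop_atTop).const_div_atTop M
  have hαt : Tendsto (fun n : ℕ => α n * (M / √(n : ℝ))) atTop (𝓝 0) := by
    have := hαo.tendsto_div_nhds_zero.const_mul M
    rw [mul_zero] at this
    refine this.congr fun n => by ring
  have hmain : ∀ᶠ n : ℕ in atTop, M / √(n : ℝ) ≤ ρ := ht0.eventually (ge_mem_nhds hρ)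
  by_cases hk : c k = minComplexity c δ μ'
  · have hind : k ∈ bestModels c δ μ' ↔ classExcess c k μ' = 0 := by
      rw [classExcess_eq_zero_iff, bestModels, Set.mem_ofPred_eq, ← hk]
      simp
    -- the first factor of the score is at least `1 - η`
    have hfirst : ∀ n : ℕ, M / √(n : ℝ) ≤ ρ →
        ∀ Q : Measure (Matrix (Fin K) (Fin K) ℝ × EuclideanSpace ℝ (Fin K)),
        IsProbabilityMeasure Q → Q.real {p | M / √(n : ℝ) < ‖p.2 - μ'‖} ≤ η →
        1 - η ≤ Q.real {p | minComplexity c δ p.2 = c k} := by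
      intro n hn Q _ hQ
      have hBm : MeasurableSet {p : Matrix (Fin K) (Fin K) ℝ × EuclideanSpace ℝ (Fin K) |
        M / √(n : ℝ) < ‖p.2 - μ'‖} := measurableSet_lt measurable_const (by fun_prop)
      have h1 := probReal_compl_eq_one_sub (μ := Q) hBm
      refine (by linarith : 1 - η ≤ _).trans (measureReal_mono fun p hp => ?_)
      have := hstab p.2 ((not_lt.1 (show ¬ M / √(n : ℝ) < ‖p.2 - μ'‖ from hp)).trans hn)
      simp only [Set.mem_ofPred_eq, hk, minComplexity, this]
    -- a best model has zero excess at `μ⁰`; the excess of the others makes the score vanish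
    by_cases hx : classExcess c k μ' = 0
    · have hexp : ∀ᶠ n : ℕ in atTop,
          1 - η ≤ Real.exp (-α n * (classExcess c k μ' + 2 * (M / √(n : ℝ)))) := by
        have : Tendsto (fun n : ℕ => Real.exp (-2 * (α n * (M / √(n : ℝ))))) atTop
            (𝓝 (Real.exp (-2 * 0))) :=
          (Real.continuous_exp.tendsto _).comp (hαt.const_mul (-2))
        refine (this.eventually (lt_mem_nhds (a := 1 - η) (by simpa using hη))).mono
          fun n hn => hn.le.trans (le_of_eq ?_)
        rw [hx]; ring_nf
      filter_upwards [hmain, hexp] with n hn hn2 Q hQp hQ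
      have hQr : Q.real {p | M / √(n : ℝ) < ‖p.2 - μ'‖} ≤ η :=
        ENNReal.toReal_le_of_le_ofReal hη.le hQ
      have h1 := hfirst n hn Q hQp hQr
      have h2 := (integral_softScore_bounds (c := c) Q (hα0 n) k hQr).1
      rw [Set.indicator_of_mem (hind.2 hx), Pi.one_apply]
      have h3 : (1 - η) * (1 - η) ≤ ∫ p, softScore c (α n) k p.2 ∂Q :=
        le_trans (by gcongr; linarith) h2
      have h4 := integral_softScore_le_one c Q (hα0 n) k
      have h5 : Q.real {p | minComplexity c δ p.2 = c k} ≤ 1 := measureReal_le_one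
      have h6 : (1 - η) * ((1 - η) * (1 - η)) ≤ slcScore c δ (α n) Q k := by
        unfold slcScore
        gcongr
        · nlinarith
      have h7 : slcScore c δ (α n) Q k ≤ 1 := by
        unfold slcScore
        exact mul_le_one₀ h5 (integral_softScore_nonneg c Q _ k) h4
      rw [abs_sub_lt_iff]
      constructor
      · linarith
      · nlinarith [mul_pos hη hη, mul_pos (mul_pos hη hη) hη]
    · have hx0 : 0 < classExcess c k μ' := lt_of_le_of_ne (classExcess_nonneg c k μ') (Ne.symm hx)
      have hexp : ∀ᶠ n : ℕ in atTop,
          Real.exp (-α n * (classExcess c k μ' - 2 * (M / √(n : ℝ)))) ≤ η := by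
        have h1 : Tendsto (fun n : ℕ => α n * (classExcess c k μ' - 2 * (M / √(n : ℝ)))) atTop
            atTop := by
          refine hαtop.atTop_mul_pos hx0 ?_
          simpa using (tendsto_const_nhds (x := classExcess c k μ')).sub (ht0.const_mul 2)
        have h2 := Real.tendsto_exp_neg_atTop_nhds_zero.comp h1
        refine (h2.eventually (ge_mem_nhds hη)).mono fun n hn => ?_
        simpa [neg_mul] using hn
      filter_upwards [hexp] with n hn2 Q hQp hQ
      have hQr : Q.real {p | M / √(n : ℝ) < ‖p.2 - μ'‖} ≤ η :=
        ENNReal.toReal_le_of_le_ofReal hη.le hQ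
      have h2 := (integral_softScore_bounds (c := c) Q (hα0 n) k hQr).2
      rw [Set.indicator_of_notMem (fun h => hx (hind.1 h)), sub_zero]
      have h5 : Q.real {p | minComplexity c δ p.2 = c k} ≤ 1 := measureReal_le_one
      have h3 := integral_softScore_nonneg c Q (α n) k
      rw [slcScore, abs_of_nonneg (by positivity)]
      calc _ ≤ 1 * ∫ p, softScore c (α n) k p.2 ∂Q := by gcongr
        _ < ε := by linarith
  · have hind : k ∉ bestModels c δ μ' := fun h => hk h.1
    filter_upwards [hmain] with n hn Q hQp hQ
    have hQr : Q.real {p | M / √(n : ℝ) < ‖p.2 - μ'‖} ≤ η :=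
      ENNReal.toReal_le_of_le_ofReal hη.le hQ
    rw [Set.indicator_of_notMem hind, sub_zero]
    have h3 := integral_softScore_nonneg c Q (α n) k
    have h4 := integral_softScore_le_one c Q (hα0 n) k
    have h5 : Q.real {p | minComplexity c δ p.2 = c k} ≤ η := by
      refine (measureReal_mono fun p hp => ?_).trans hQr
      by_contra hlt
      have := hstab p.2 ((not_lt.1 hlt).trans hn)
      refine hk ?_
      rw [← (show minComplexity c δ p.2 = c k from hp), minComplexity, minComplexity, this]
    rw [slcScore, abs_of_nonneg (by positivity)]
    calc _ ≤ η * 1 := by gcongr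
      _ < ε := by linarith

/-! ### A second-order increment bound -/

section Taylor

variable {d : ℕ}

theorem euclideanSpace_eq_sum_single (u : EuclideanSpace ℝ (Fin d)) :
    u = ∑ i, u i • EuclideanSpace.single i (1 : ℝ) := by
  ext j
  simp [Finset.sum_apply, Pi.single_apply]

/-- The operator norm of a bilinear form is at most the Frobenius norm of its matrix. -/
theorem opNorm_le_frobeniusNorm
    (L : EuclideanSpace ℝ (Fin d) →L[ℝ] EuclideanSpace ℝ (Fin d) →L[ℝ] ℝ) :
    ‖L‖ ≤ frobeniusNorm (Matrix.of fun i j =>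
      L (EuclideanSpace.single i 1) (EuclideanSpace.single j 1)) := by
  set A : Matrix (Fin d) (Fin d) ℝ :=
    Matrix.of fun i j => L (EuclideanSpace.single i 1) (EuclideanSpace.single j 1) with hA
  have hF : 0 ≤ frobeniusNorm A := Real.sqrt_nonneg _
  refine L.opNorm_le_bound hF fun u => ?_
  refine (L u).opNorm_le_bound (by positivity) fun v => ?_
  have h1 : L u v = ∑ p : Fin d × Fin d, A p.1 p.2 * (u p.1 * v p.2) := by
    conv_lhs => rw [euclideanSpace_eq_sum_single u, euclideanSpace_eq_sum_single v]
    simp only [map_sum, map_smul, _root_.sum_apply, _root_.smul_apply,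
      smul_eq_mul, Fintype.sum_prod_type, hA, Matrix.of_apply, Finset.mul_sum]
    rw [Finset.sum_comm]
    exact Finset.sum_congr rfl fun i _ => Finset.sum_congr rfl fun j _ => by ring
  have h2 : (∑ p : Fin d × Fin d, (u p.1 * v p.2) ^ 2) = (‖u‖ * ‖v‖) ^ 2 := by
    rw [mul_pow, EuclideanSpace.real_norm_sq_eq, EuclideanSpace.real_norm_sq_eq,
      Finset.sum_mul_sum, Fintype.sum_prod_type]
    simp_rw [mul_pow]
  have h3 : (∑ p : Fin d × Fin d, A p.1 p.2 ^ 2) = frobeniusNorm A ^ 2 := by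
    rw [frobeniusNorm, Real.sq_sqrt (by positivity), Fintype.sum_prod_type]
  rw [Real.norm_eq_abs, mul_assoc]
  refine abs_le_of_sq_le_sq ?_ (by positivity)
  rw [h1, mul_pow, ← h2, ← h3]
  exact Finset.sum_mul_sq_le_sq_mul_sq _ _ _

/-- The increment of a `C²` function whose Hessian has Frobenius norm at most `H` on a ball:
the mean value inequality for the derivative, and then for the function. -/
theorem abs_sub_le_of_frobeniusNorm_hessianMatrix_le {f : EuclideanSpace ℝ (Fin d) → ℝ}
    {θ₀ : EuclideanSpace ℝ (Fin d)} {r H : ℝ} (hf : ContDiffOn ℝ 2 f (Metric.ball θ₀ r))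
    (hH : ∀ θ ∈ Metric.ball θ₀ r, frobeniusNorm (hessianMatrix f θ) ≤ H)
    {θ : EuclideanSpace ℝ (Fin d)} (hθ : θ ∈ Metric.ball θ₀ r) :
    |f θ - f θ₀| ≤ ‖gradient f θ₀‖ * ‖θ - θ₀‖ + H * ‖θ - θ₀‖ ^ 2 := by
  have hr : 0 < r := lt_of_le_of_lt dist_nonneg (Metric.mem_ball.1 hθ)
  have h0 : θ₀ ∈ Metric.ball θ₀ r := Metric.mem_ball_self hr
  have hopen := Metric.isOpen_ball (x := θ₀) (ε := r)
  have hd1 : ∀ η ∈ Metric.ball θ₀ r, DifferentiableAt ℝ f η := fun η hη =>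
    (hf.differentiableOn (by norm_num)).differentiableAt (hopen.mem_nhds hη)
  have hd2 : ∀ η ∈ Metric.ball θ₀ r, DifferentiableAt ℝ (fderiv ℝ f) η := fun η hη =>
    ((hf.fderiv_of_isOpen hopen (m := 1) (by norm_num)).differentiableOn
      (by norm_num)).differentiableAt (hopen.mem_nhds hη)
  have hbound : ∀ η ∈ Metric.ball θ₀ r, ‖fderiv ℝ (fderiv ℝ f) η‖ ≤ H := by
    intro η hη
    refine (opNorm_le_frobeniusNorm _).trans (le_trans (le_of_eq ?_) (hH η hη))
    congr 1
    ext i j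
    simp only [hessianMatrix, Matrix.of_apply]
    rw [fderiv_clm_apply (hd2 η hη) (differentiableAt_const _)]
    simp
  set ρ := ‖θ - θ₀‖ with hρ
  have hsub : Metric.closedBall θ₀ ρ ⊆ Metric.ball θ₀ r :=
    Metric.closedBall_subset_ball (by rwa [Metric.mem_ball, dist_eq_norm] at hθ)
  have hH0 : 0 ≤ H := (Real.sqrt_nonneg _).trans (hH θ₀ h0)
  have hgrad : ∀ η ∈ Metric.closedBall θ₀ ρ, ‖fderiv ℝ f η‖ ≤ ‖gradient f θ₀‖ + H * ρ := by
    intro η hη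
    have h1 := (convex_ball θ₀ r).norm_image_sub_le_of_norm_fderiv_le hd2 hbound h0 (hsub hη)
    have h2 : ‖gradient f θ₀‖ = ‖fderiv ℝ f θ₀‖ := by
      rw [gradient, LinearIsometryEquiv.norm_map]
    have h3 : ‖η - θ₀‖ ≤ ρ := by rwa [Metric.mem_closedBall, dist_eq_norm] at hη
    calc ‖fderiv ℝ f η‖ = ‖fderiv ℝ f θ₀ + (fderiv ℝ f η - fderiv ℝ f θ₀)‖ := by congr 1; abel
      _ ≤ ‖fderiv ℝ f θ₀‖ + ‖fderiv ℝ f η - fderiv ℝ f θ₀‖ := norm_add_le _ _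
      _ ≤ ‖gradient f θ₀‖ + H * ρ := by
          rw [h2]; gcongr
          exact h1.trans (by gcongr)
  have h4 := (convex_closedBall θ₀ ρ).norm_image_sub_le_of_norm_fderiv_le
    (fun η hη => hd1 η (hsub hη)) hgrad (Metric.mem_closedBall_self (norm_nonneg _))
    (show θ ∈ Metric.closedBall θ₀ ρ by rw [Metric.mem_closedBall, dist_eq_norm])
  rw [← Real.norm_eq_abs]
  calc ‖f θ - f θ₀‖ ≤ (‖gradient f θ₀‖ + H * ρ) * ρ := h4
    _ = _ := by ring

end Taylor

/-! ### Empirical averages and posterior parameters -/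

section EmpiricalMeans

variable {n : ℕ}

/-- Empirical average of finitely many reals. -/
noncomputable def empMean (z : Fin n → ℝ) : ℝ := (n : ℝ)⁻¹ * ∑ i, z i

theorem empMean_add (y z : Fin n → ℝ) :
    empMean (fun i => y i + z i) = empMean y + empMean z := by
  simp only [empMean, Finset.sum_add_distrib, mul_add]

theorem empMean_sub (y z : Fin n → ℝ) :
    empMean (fun i => y i - z i) = empMean y - empMean z := by
  simp only [empMean, Finset.sum_sub_distrib, mul_sub]

theorem empMean_const_mul (a : ℝ) (z : Fin n → ℝ) :
    empMean (fun i => a * z i) = a * empMean z := by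
  simp only [empMean, ← Finset.mul_sum]
  ring

theorem empMean_mono {y z : Fin n → ℝ} (h : ∀ i, y i ≤ z i) : empMean y ≤ empMean z := by
  unfold empMean
  gcongr with i
  exact h i

theorem empMean_nonneg {z : Fin n → ℝ} (h : ∀ i, 0 ≤ z i) : 0 ≤ empMean z :=
  mul_nonneg (by positivity) (Finset.sum_nonneg fun i _ => h i)

theorem empMean_const (hn : n ≠ 0) (a : ℝ) : empMean (fun _ : Fin n => a) = a := by
  have : (n : ℝ) ≠ 0 := by exact_mod_cast hn
  simp only [empMean, Finset.sum_const, Finset.card_univ, Fintype.card_fin, nsmul_eq_mul]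
  field_simp

/-- Cauchy-Schwarz inequality for empirical averages. -/
theorem abs_empMean_mul_le {y z : Fin n → ℝ} {a b : ℝ} (ha : 0 ≤ a) (hb : 0 ≤ b)
    (hy : empMean (fun i => y i ^ 2) ≤ a ^ 2) (hz : empMean (fun i => z i ^ 2) ≤ b ^ 2) :
    |empMean fun i => y i * z i| ≤ a * b := by
  refine abs_le_of_sq_le_sq ?_ (by positivity)
  calc (empMean fun i => y i * z i) ^ 2
      = (n : ℝ)⁻¹ ^ 2 * (∑ i, y i * z i) ^ 2 := by rw [empMean, mul_pow]
    _ ≤ (n : ℝ)⁻¹ ^ 2 * ((∑ i, y i ^ 2) * ∑ i, z i ^ 2) := by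
        gcongr; exact Finset.sum_mul_sq_le_sq_mul_sq _ _ _
    _ = (empMean fun i => y i ^ 2) * empMean fun i => z i ^ 2 := by unfold empMean; ring
    _ ≤ a ^ 2 * b ^ 2 := by
        gcongr
        exact empMean_nonneg fun i => sq_nonneg _
    _ = (a * b) ^ 2 := by ring

theorem abs_empMean_le {y : Fin n → ℝ} {a : ℝ} (ha : 0 ≤ a)
    (hy : empMean (fun i => y i ^ 2) ≤ a ^ 2) : |empMean y| ≤ a := by
  rcases Nat.eq_zero_or_pos n with rfl | hn
  · simpa [empMean] using ha
  · have := abs_empMean_mul_le (z := fun _ => 1) (b := 1) ha zero_le_one hy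
      (by simp [empMean_const hn.ne'])
    simpa using this

/-- Perturbation of averages of products under a mean-square perturbation of the factors. -/
theorem abs_empMean_mul_sub_le {y z y' z' : Fin n → ℝ} {κ L : ℝ} (hκ : 0 ≤ κ) (hL : 0 ≤ L)
    (hz : empMean (fun i => (z i - y i) ^ 2) ≤ κ ^ 2)
    (hz' : empMean (fun i => (z' i - y' i) ^ 2) ≤ κ ^ 2)
    (hy : empMean (fun i => y i ^ 2) ≤ L ^ 2) (hy' : empMean (fun i => y' i ^ 2) ≤ L ^ 2) :
    |empMean (fun i => z i * z' i) - empMean (fun i => y i * y' i)| ≤ 2 * κ * L + κ ^ 2 := by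
  have h : empMean (fun i => z i * z' i) - empMean (fun i => y i * y' i) =
      empMean (fun i => (z i - y i) * y' i) + empMean (fun i => y i * (z' i - y' i)) +
        empMean (fun i => (z i - y i) * (z' i - y' i)) := by
    rw [← empMean_sub, ← empMean_add, ← empMean_add]
    congr 1; ext i; ring
  have h1 := abs_empMean_mul_le hκ hL hz hy'
  have h2 := abs_empMean_mul_le hL hκ hy hz'
  have h3 := abs_empMean_mul_le hκ hκ hz hz'
  rw [h]
  calc _ ≤ _ := abs_add_three _ _ _
    _ ≤ κ * L + L * κ + κ * κ := by gcongr
    _ = _ := by ring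

variable {K : ℕ}

theorem sampleMean_apply (Z : Fin n → EuclideanSpace ℝ (Fin K)) (k : Fin K) :
    sampleMean Z k = empMean fun i => Z i k := by
  simp [sampleMean, empMean]

theorem sampleCov_apply (hn : n ≠ 0) (Z : Fin n → EuclideanSpace ℝ (Fin K)) (j k : Fin K) :
    sampleCov Z j k = empMean (fun i => Z i j * Z i k) -
      empMean (fun i => Z i j) * empMean fun i => Z i k := by
  have h : sampleCov Z j k =
      empMean fun i => (Z i j - sampleMean Z j) * (Z i k - sampleMean Z k) := by
    simp [sampleCov, empMean, outerSelf, Matrix.sum_apply]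
  have h2 : (fun i => (Z i j - sampleMean Z j) * (Z i k - sampleMean Z k)) =
      fun i => (Z i j * Z i k - sampleMean Z k * Z i j) -
        (sampleMean Z j * Z i k - sampleMean Z j * sampleMean Z k) := by
    ext i; ring
  rw [h, h2, empMean_sub, empMean_sub, empMean_sub, empMean_const_mul, empMean_const_mul,
    empMean_const hn, sampleMean_apply, sampleMean_apply]
  ring

/-- Stability of sample means and sample covariances under mean-square perturbations. -/
theorem sampleMean_sampleCov_perturbation (hn : n ≠ 0)
    {Y Z : Fin n → EuclideanSpace ℝ (Fin K)} {κ L : ℝ} (hκ : 0 ≤ κ) (hL : 0 ≤ L)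
    (hD : ∀ k, empMean (fun i => (Z i k - Y i k) ^ 2) ≤ κ ^ 2)
    (hY : ∀ k, empMean (fun i => Y i k ^ 2) ≤ L ^ 2) :
    (∀ k, |sampleMean Z k - sampleMean Y k| ≤ κ) ∧
      ∀ j k, |sampleCov Z j k - sampleCov Y j k| ≤ 2 * (2 * κ * L + κ ^ 2) := by
  have hm : ∀ k, |sampleMean Z k - sampleMean Y k| ≤ κ := fun k => by
    rw [sampleMean_apply, sampleMean_apply, ← empMean_sub]
    exact abs_empMean_le hκ (hD k)
  refine ⟨hm, fun j k => ?_⟩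
  have h1 := abs_empMean_mul_sub_le hκ hL (hD j) (hD k) (hY j) (hY k)
  have hj := hm j
  have hk := hm k
  have hYj : |sampleMean Y j| ≤ L := by
    rw [sampleMean_apply]; exact abs_empMean_le hL (hY j)
  have hYk : |sampleMean Y k| ≤ L := by
    rw [sampleMean_apply]; exact abs_empMean_le hL (hY k)
  rw [sampleCov_apply hn, sampleCov_apply hn]
  simp only [sampleMean_apply] at hj hk hYj hYk
  set zj := empMean fun i => Z i j
  set zk := empMean fun i => Z i k
  set yj := empMean fun i => Y i j
  set yk := empMean fun i => Y i k
  have h2 : |zj * zk - yj * yk| ≤ 2 * κ * L + κ ^ 2 := by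
    calc |zj * zk - yj * yk| = |(zj - yj) * yk + yj * (zk - yk) + (zj - yj) * (zk - yk)| := by
          congr 1; ring
      _ ≤ |zj - yj| * |yk| + |yj| * |zk - yk| + |zj - yj| * |zk - yk| := by
          rw [← abs_mul, ← abs_mul, ← abs_mul]; exact abs_add_three _ _ _
      _ ≤ κ * L + L * κ + κ * κ := by gcongr
      _ = _ := by ring
  rw [abs_le] at h1 h2 ⊢
  constructor <;> linarith [h1.1, h1.2, h2.1, h2.2]

end EmpiricalMeans

section PosteriorParameters

variable {K : ℕ}

/-- The quadratic form of a positive definite matrix is bounded below on the unit sphere. -/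
theorem Matrix.PosDef.exists_pos_mul_le {S : Matrix (Fin K) (Fin K) ℝ} (hS : S.PosDef) :
    ∃ a : ℝ, 0 < a ∧ ∀ x : Fin K → ℝ, a * (x ⬝ᵥ x) ≤ x ⬝ᵥ (S *ᵥ x) := by
  rcases isEmpty_or_nonempty (Fin K) with hK | hK
  · exact ⟨1, one_pos, fun x => by simp [dotProduct]⟩
  have hc : Continuous fun x : EuclideanSpace ℝ (Fin K) => x.ofLp ⬝ᵥ (S *ᵥ x.ofLp) := by fun_prop
  have hne : (Metric.sphere (0 : EuclideanSpace ℝ (Fin K)) 1).Nonempty :=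
    ⟨EuclideanSpace.single (Classical.arbitrary _) 1, by simp⟩
  obtain ⟨x₀, hx₀, hmin⟩ := (isCompact_sphere (0 : EuclideanSpace ℝ (Fin K)) 1).exists_isMinOn
    hne hc.continuousOn
  have hx₀0 : x₀.ofLp ≠ 0 := by
    intro h
    have h2 : x₀ = 0 := by ext i; simpa using congrFun h i
    simp [h2] at hx₀
  refine ⟨x₀.ofLp ⬝ᵥ (S *ᵥ x₀.ofLp), by simpa using hS.dotProduct_mulVec_pos hx₀0, fun x => ?_⟩
  set y : EuclideanSpace ℝ (Fin K) := WithLp.toLp 2 x with hy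
  have hxx : x ⬝ᵥ x = ‖y‖ ^ 2 := by
    rw [EuclideanSpace.real_norm_sq_eq]; simp [dotProduct, sq, hy]
  rcases eq_or_ne y 0 with h0 | h0
  · have : x = 0 := by simpa [hy] using h0
    simp [this]
  have hny : ‖y‖ ≠ 0 := norm_ne_zero_iff.2 h0
  have hmem : ‖y‖⁻¹ • y ∈ Metric.sphere (0 : EuclideanSpace ℝ (Fin K)) 1 := by
    simp [norm_smul, hny]
  have h1 : x₀.ofLp ⬝ᵥ (S *ᵥ x₀.ofLp) ≤ ‖y‖⁻¹ * (‖y‖⁻¹ * (x ⬝ᵥ (S *ᵥ x))) := by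
    simpa [hy, mulVec_smul] using hmin hmem
  rw [hxx]
  calc _ ≤ ‖y‖⁻¹ * (‖y‖⁻¹ * (x ⬝ᵥ (S *ᵥ x))) * ‖y‖ ^ 2 := by gcongr
    _ = _ := by field_simp

theorem dotProduct_outerSelf_mulVec (v : EuclideanSpace ℝ (Fin K)) (x : Fin K → ℝ) :
    x ⬝ᵥ (outerSelf v *ᵥ x) = (x ⬝ᵥ v.ofLp) ^ 2 := by
  rw [sq]
  simp only [dotProduct, mulVec, outerSelf, Matrix.of_apply, Finset.sum_mul_sum]
  simp only [Finset.mul_sum]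
  exact Finset.sum_congr rfl fun i _ => Finset.sum_congr rfl fun j _ => by ring

/-- Root-`n` concentration of the posterior of `μ` around `μ⁰` for all data whose sample mean is
within `M / √n` of `μ⁰` and whose sample covariance is close to a positive definite `Σ⁰`. -/
theorem exists_niwPosterior_concentration (μ' : EuclideanSpace ℝ (Fin K))
    {S' : Matrix (Fin K) (Fin K) ℝ} (hS' : S'.PosDef)
    (μ₀ : EuclideanSpace ℝ (Fin K)) {l₀ : ℝ} (hl₀ : 0 < l₀)
    {Ψ₀ : Matrix (Fin K) (Fin K) ℝ} (hΨ₀ : Ψ₀.PosDef) {ν₀ : ℝ} (hν₀ : (K : ℝ) - 1 < ν₀) :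
    ∃ τ : ℝ, 0 < τ ∧ ∀ M : ℝ, 0 ≤ M → ∀ η : ℝ≥0∞, 0 < η → ∃ M' : ℝ, ∀ᶠ n : ℕ in atTop,
      ∀ Z : Fin n → EuclideanSpace ℝ (Fin K), ‖sampleMean Z - μ'‖ ≤ M / √(n : ℝ) →
        (∀ i j, |sampleCov Z i j - S' i j| ≤ τ) →
        IsProbabilityMeasure (niwPosterior μ₀ l₀ Ψ₀ ν₀ Z) ∧
          niwPosterior μ₀ l₀ Ψ₀ ν₀ Z {p | M' / √(n : ℝ) < ‖p.2 - μ'‖} ≤ η := by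
  obtain ⟨a, ha, haS⟩ := hS'.exists_pos_mul_le
  refine ⟨a / (2 * (K + 1)), by positivity, fun M hM η hη => ?_⟩
  set τ := a / (2 * ((K : ℝ) + 1)) with hτ
  have hτ0 : 0 < τ := by positivity
  set B : ℝ := M + ‖μ' - μ₀‖ with hB
  have hB0 : 0 ≤ B := by positivity
  set b : ℝ := (∑ i, ∑ j, |Ψ₀ i j|) + (τ + ∑ i, ∑ j, |S' i j|) + l₀ * B ^ 2 with hb
  have hb0 : 0 ≤ b := by positivity
  obtain ⟨M₁, hM₁, E, hE⟩ := exists_normalInvWishart_concentration K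
    (show 0 < a / 4 by positivity) hb0 hη
  refine ⟨M₁ + (l₀ * ‖μ₀ - μ'‖ + M), ?_⟩
  have hlarge : ∀ᶠ n : ℕ in atTop, (1 : ℝ) ≤ n ∧ ν₀ + K + 1 ≤ n ∧ 2 * E ≤ n :=
    (tendsto_natCast_atTop_atTop.eventually_ge_atTop _).and
      ((tendsto_natCast_atTop_atTop.eventually_ge_atTop _).and
        (tendsto_natCast_atTop_atTop.eventually_ge_atTop _))
  filter_upwards [hlarge] with n ⟨hn1, hnν, hnE⟩ Z hmean hcov
  have hn0 : (0 : ℝ) < n := by linarith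
  have hsq1 : 1 ≤ √(n : ℝ) := Real.one_le_sqrt.2 hn1
  have hK0 : (0 : ℝ) ≤ K := Nat.cast_nonneg K
  have he_lower : (n : ℝ) ≤ 2 * invWishartExponent K (ν₀ + n) := by
    unfold invWishartExponent; linarith
  have he_upper : invWishartExponent K (ν₀ + n) ≤ n := by
    unfold invWishartExponent; linarith
  have hentry : ∀ (A : Matrix (Fin K) (Fin K) ℝ) i j, |A i j| ≤ ∑ i, ∑ j, |A i j| := by
    intro A i j
    calc |A i j| ≤ ∑ j, |A i j| :=
          Finset.single_le_sum (f := fun j => |A i j|) (fun _ _ => abs_nonneg _)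
            (Finset.mem_univ j)
      _ ≤ _ := Finset.single_le_sum (f := fun i => ∑ j, |A i j|)
          (fun _ _ => Finset.sum_nonneg fun _ _ => abs_nonneg _) (Finset.mem_univ i)
  have hmean1 : ‖sampleMean Z - μ₀‖ ≤ B := by
    calc ‖sampleMean Z - μ₀‖ = ‖(sampleMean Z - μ') + (μ' - μ₀)‖ := by congr 1; abel
      _ ≤ ‖sampleMean Z - μ'‖ + ‖μ' - μ₀‖ := norm_add_le _ _
      _ ≤ M + ‖μ' - μ₀‖ := by gcongr; exact hmean.trans (div_le_self hM hsq1)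
  have hweight0 : 0 ≤ l₀ * n / (l₀ + n) := by positivity
  have hweight : l₀ * n / (l₀ + n) ≤ l₀ := by
    rw [div_le_iff₀ (by positivity)]; nlinarith
  -- the posterior scale matrix is of the order of the exponent `e`, as `e ≤ n ≤ 2 e`
  have hlow : ∀ x : Fin K → ℝ, 2 * (a / 4) * invWishartExponent K (ν₀ + n) * (x ⬝ᵥ x) ≤
      x ⬝ᵥ ((Ψ₀ + (n : ℝ) • sampleCov Z +
        (l₀ * n / (l₀ + n)) • outerSelf (sampleMean Z - μ₀)) *ᵥ x) := by
    intro x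
    have hxx : 0 ≤ x ⬝ᵥ x := by simpa using dotProduct_star_self_nonneg x
    have h1 : 0 ≤ x ⬝ᵥ (Ψ₀ *ᵥ x) := by
      simpa using hΨ₀.posSemidef.dotProduct_mulVec_nonneg x
    have h2 : |x ⬝ᵥ ((sampleCov Z - S') *ᵥ x)| ≤ τ * K * (x ⬝ᵥ x) :=
      Matrix.abs_dotProduct_mulVec_le (fun i j => by simpa using hcov i j) x
    have h3 : τ * K ≤ a / 2 := by
      rw [hτ, div_mul_eq_mul_div, div_le_div_iff₀ (by positivity) (by norm_num)]
      nlinarith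
    have h4 : a / 2 * (x ⬝ᵥ x) ≤ x ⬝ᵥ (sampleCov Z *ᵥ x) := by
      have h5 := (abs_le.1 h2).1
      rw [sub_mulVec, dotProduct_sub] at h5
      have h6 : τ * K * (x ⬝ᵥ x) ≤ a / 2 * (x ⬝ᵥ x) := by gcongr
      linarith [haS x]
    have h7 : 0 ≤ l₀ * n / (l₀ + n) * (x ⬝ᵥ (outerSelf (sampleMean Z - μ₀) *ᵥ x)) := by
      rw [dotProduct_outerSelf_mulVec]; positivity
    simp only [add_mulVec, dotProduct_add, smul_mulVec, dotProduct_smul, smul_eq_mul]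
    calc _ ≤ 2 * (a / 4) * n * (x ⬝ᵥ x) := by gcongr
      _ = n * (a / 2 * (x ⬝ᵥ x)) := by ring
      _ ≤ n * (x ⬝ᵥ (sampleCov Z *ᵥ x)) := by gcongr
      _ ≤ _ := by linarith
  have hup : ∀ i j, |(Ψ₀ + (n : ℝ) • sampleCov Z +
        (l₀ * n / (l₀ + n)) • outerSelf (sampleMean Z - μ₀)) i j| ≤
      2 * b * invWishartExponent K (ν₀ + n) := by
    intro i j
    have h1 : |sampleCov Z i j| ≤ τ + ∑ i, ∑ j, |S' i j| := by
      calc |sampleCov Z i j| = |(sampleCov Z i j - S' i j) + S' i j| := by congr 1; ring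
        _ ≤ _ := (abs_add_le _ _).trans (add_le_add (hcov i j) (hentry S' i j))
    have h2 : |outerSelf (sampleMean Z - μ₀) i j| ≤ B ^ 2 := by
      rw [outerSelf, Matrix.of_apply, abs_mul, sq]
      gcongr
      · exact (PiLp.norm_apply_le (sampleMean Z - μ₀) i).trans hmean1
      · exact (PiLp.norm_apply_le (sampleMean Z - μ₀) j).trans hmean1
    simp only [Matrix.add_apply, Matrix.smul_apply, smul_eq_mul]
    calc _ ≤ |Ψ₀ i j| + |(n : ℝ) * sampleCov Z i j| +
          |l₀ * n / (l₀ + n) * outerSelf (sampleMean Z - μ₀) i j| := abs_add_three _ _ _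
      _ ≤ (∑ i, ∑ j, |Ψ₀ i j|) + n * (τ + ∑ i, ∑ j, |S' i j|) + l₀ * B ^ 2 := by
          rw [abs_mul, abs_mul, abs_of_pos hn0, abs_of_nonneg hweight0]
          gcongr
          exact hentry Ψ₀ i j
      _ ≤ n * (∑ i, ∑ j, |Ψ₀ i j|) + n * (τ + ∑ i, ∑ j, |S' i j|) + n * (l₀ * B ^ 2) := by
          have h3 : 0 ≤ ∑ i, ∑ j, |Ψ₀ i j| := by positivity
          linarith [le_mul_of_one_le_left h3 hn1,
            le_mul_of_one_le_left (show 0 ≤ l₀ * B ^ 2 by positivity) hn1]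
      _ = b * n := by rw [hb]; ring
      _ ≤ b * (2 * invWishartExponent K (ν₀ + n)) := by gcongr
      _ = _ := by ring
  obtain ⟨hprob, hconc⟩ := hE (ν₀ + n) (by linarith) _ hlow hup
    ((l₀ + n)⁻¹ • (l₀ • μ₀ + (n : ℝ) • sampleMean Z)) (l₀ + n) (by positivity)
  refine ⟨hprob, (measure_mono fun p hp => ?_).trans hconc⟩
  simp only [Set.mem_ofPred_eq] at hp ⊢
  set m := (l₀ + n)⁻¹ • (l₀ • μ₀ + (n : ℝ) • sampleMean Z) with hm
  -- the prior mean moves the location parameter by `O(1 / n)` only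
  have hmμ : ‖m - μ'‖ ≤ (l₀ * ‖μ₀ - μ'‖ + M) / √(n : ℝ) := by
    have h1 : m - μ' = (l₀ + n)⁻¹ • (l₀ • (μ₀ - μ') + (n : ℝ) • (sampleMean Z - μ')) := by
      have h2 : μ' = (l₀ + n)⁻¹ • ((l₀ + n) • μ') := by
        rw [smul_smul, inv_mul_cancel₀ (by positivity), one_smul]
      conv_lhs => rw [h2]
      rw [hm, ← smul_sub]
      congr 1
      module
    have h3 : (n : ℝ) = √n * √n := (Real.mul_self_sqrt hn0.le).symm
    calc ‖m - μ'‖ ≤ (l₀ + n)⁻¹ * (l₀ * ‖μ₀ - μ'‖ + n * (M / √n)) := by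
          rw [h1, norm_smul, Real.norm_of_nonneg (by positivity)]
          gcongr
          refine (norm_add_le _ _).trans ?_
          rw [norm_smul, norm_smul, Real.norm_of_nonneg hl₀.le, Real.norm_of_nonneg hn0.le]
          gcongr
      _ ≤ (n : ℝ)⁻¹ * (√n * (l₀ * ‖μ₀ - μ'‖) + n * (M / √n)) := by
          gcongr ?_ * (?_ + _)
          · exact inv_anti₀ hn0 (by linarith)
          · exact le_mul_of_one_le_left (by positivity) hsq1
      _ = _ := by
          have : √(n : ℝ) ≠ 0 := by positivity
          rw [h3, Real.sqrt_mul_self (by positivity)]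
          field_simp
  have h4 : ‖p.2 - μ'‖ ≤ ‖p.2 - m‖ + ‖m - μ'‖ := norm_sub_le_norm_sub_add_norm_sub _ _ _
  have h5 : M₁ / √(l₀ + n) ≤ M₁ / √(n : ℝ) := by gcongr; linarith
  rw [add_div] at hp
  linarith

end PosteriorParameters

/-! ### Events of asymptotically large probability -/

section HoldsInProbability

variable {Ω : Type*} [MeasurableSpace Ω] {prob : Measure Ω}

/-- The events `p M n` have probability at least `1 - ε` for `M` large and then `n` large. With
`p M n = (|Y n| ≤ M a n)` this is `Y n = O_p(a n)`; for `p` independent of `M` it says that the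
probability of `p n` tends to one. -/
def HoldsInProbability (prob : Measure Ω) (p : ℝ → ℕ → Ω → Prop) : Prop :=
  ∀ ε : ℝ≥0∞, 0 < ε → ∃ M₀ : ℝ, ∀ M, M₀ ≤ M → ∀ᶠ n in atTop, prob {ω | ¬ p M n ω} ≤ ε

theorem HoldsInProbability.and {p q : ℝ → ℕ → Ω → Prop} (hp : HoldsInProbability prob p)
    (hq : HoldsInProbability prob q) : HoldsInProbability prob fun M n ω => p M n ω ∧ q M n ω := by
  intro ε hε
  obtain ⟨M₁, h1⟩ := hp (ε / 2) (ENNReal.half_pos hε.ne')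
  obtain ⟨M₂, h2⟩ := hq (ε / 2) (ENNReal.half_pos hε.ne')
  refine ⟨max M₁ M₂, fun M hM => ?_⟩
  filter_upwards [h1 M ((le_max_left _ _).trans hM), h2 M ((le_max_right _ _).trans hM)]
    with n hn1 hn2
  calc prob {ω | ¬ (p M n ω ∧ q M n ω)} ≤ prob ({ω | ¬ p M n ω} ∪ {ω | ¬ q M n ω}) :=
        measure_mono fun ω hω => not_and_or.1 hω
    _ ≤ ε / 2 + ε / 2 := (measure_union_le _ _).trans (add_le_add hn1 hn2)
    _ = ε := ENNReal.add_halves ε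

theorem HoldsInProbability.forall {ι : Type*} [Finite ι] {p : ι → ℝ → ℕ → Ω → Prop}
    (hp : ∀ i, HoldsInProbability prob (p i)) :
    HoldsInProbability prob fun M n ω => ∀ i, p i M n ω := by
  have := Fintype.ofFinite ι
  intro ε hε
  have hε' : 0 < ε / (Fintype.card ι + 1 : ℕ) :=
    ENNReal.div_pos hε.ne' (ENNReal.natCast_ne_top _)
  choose M₀ h using fun i => hp i _ hε'
  refine ⟨∑ i, |M₀ i|, fun M hM => ?_⟩
  have hle : ∀ i, M₀ i ≤ M := fun i => (le_abs_self _).trans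
    ((Finset.single_le_sum (f := fun i => |M₀ i|) (fun _ _ => abs_nonneg _)
      (Finset.mem_univ i)).trans hM)
  filter_upwards [eventually_all.2 fun i => h i M (hle i)] with n hn
  calc prob {ω | ¬ ∀ i, p i M n ω} ≤ prob (⋃ i, {ω | ¬ p i M n ω}) :=
        measure_mono fun ω hω => by
          obtain ⟨i, hi⟩ := not_forall.1 hω
          exact Set.mem_iUnion.2 ⟨i, hi⟩
    _ ≤ ∑ i, prob {ω | ¬ p i M n ω} := measure_iUnion_fintype_le _ _
    _ ≤ ∑ _i : ι, ε / (Fintype.card ι + 1 : ℕ) := Finset.sum_le_sum fun i _ => hn i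
    _ ≤ (Fintype.card ι + 1 : ℕ) * (ε / (Fintype.card ι + 1 : ℕ)) := by
        rw [Finset.sum_const, Finset.card_univ, nsmul_eq_mul]
        gcongr
        exact Nat.le_succ _
    _ ≤ ε := ENNReal.mul_div_le

/-- Deterministic consequences of events of large probability; the constant may deteriorate from
`M` to `F M`. -/
theorem HoldsInProbability.mono {p q : ℝ → ℕ → Ω → Prop} (hp : HoldsInProbability prob p)
    (F : ℝ → ℝ)
    (h : ∀ M, 0 ≤ M → ∀ M', F M ≤ M' → ∀ᶠ n in atTop, ∀ ω, p M n ω → q M' n ω) :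
    HoldsInProbability prob q := by
  intro ε hε
  obtain ⟨M₀, h0⟩ := hp ε hε
  refine ⟨F (max M₀ 0), fun M' hM' => ?_⟩
  filter_upwards [h0 _ (le_max_left M₀ 0), h _ (le_max_right M₀ 0) M' hM'] with n hn1 hn2
  refine (measure_mono fun ω hω => ?_).trans hn1
  exact fun hpω => hω (hn2 ω hpω)

theorem TendstoInMeasure.holdsInProbability {f : ℕ → Ω → ℝ} {a : ℝ}
    (h : TendstoInMeasure prob f atTop fun _ => a) {t : ℝ} (ht : 0 < t) :
    HoldsInProbability prob fun _ n ω => |f n ω - a| < t := by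
  intro ε hε
  refine ⟨0, fun M _ => ?_⟩
  refine ((tendstoInMeasure_iff_norm.1 h t ht).eventually (ge_mem_nhds hε)).mono fun n hn => ?_
  simpa only [not_lt, Real.norm_eq_abs] using hn

theorem IsBigOInProbability.holdsInProbability {Y : ℕ → Ω → ℝ} {a : ℕ → ℝ}
    (h : IsBigOInProbability prob Y a) (ha : ∀ n, 0 ≤ a n) :
    HoldsInProbability prob fun M n ω => |Y n ω| ≤ M * a n := by
  intro ε hε
  obtain ⟨M₀, h0⟩ := h ε hε
  refine ⟨M₀, fun M hM => h0.mono fun n hn => (measure_mono fun ω hω => ?_).trans hn⟩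
  exact lt_of_le_of_lt (mul_le_mul_of_nonneg_right hM (ha n)) (not_le.1 hω)

end HoldsInProbability

/-! ### Limit theorems for an i.i.d. sample -/

section Sample

variable {𝒳 : Type*} [MeasurableSpace 𝒳] {P : Measure 𝒳}
  {Ω : Type*} [MeasurableSpace Ω] {prob : Measure Ω}

/-- `X 0, X 1, …` are independent with common law `P`. -/
structure IsIIDSample (P : Measure 𝒳) (prob : Measure Ω) (X : ℕ → Ω → 𝒳) : Prop where
  measurable : ∀ i, Measurable (X i)
  indep : iIndepFun X prob
  law : ∀ i, prob.map (X i) = P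

variable {X : ℕ → Ω → 𝒳}

theorem IsIIDSample.measurePreserving (hX : IsIIDSample P prob X) (i : ℕ) :
    MeasurePreserving (X i) prob P := ⟨hX.measurable i, hX.law i⟩

theorem empMean_eq_sum_range_div (z : ℕ → ℝ) (n : ℕ) :
    empMean (fun i : Fin n => z i) = (∑ i ∈ Finset.range n, z i) / n := by
  rw [empMean, Fin.sum_univ_eq_sum_range, div_eq_inv_mul]

theorem IsIIDSample.aestronglyMeasurable_empMean (hX : IsIIDSample P prob X) {φ : 𝒳 → ℝ}
    (hφ : AEStronglyMeasurable φ P) (n : ℕ) :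
    AEStronglyMeasurable (fun ω => empMean fun i : Fin n => φ (X i ω)) prob := by
  unfold empMean
  refine AEStronglyMeasurable.const_mul ?_ _
  exact Finset.aestronglyMeasurable_fun_sum _ fun i _ =>
    hφ.comp_measurePreserving (hX.measurePreserving i)

/-- Strong law of large numbers for functions of the observations. -/
theorem IsIIDSample.ae_tendsto_empMean (hX : IsIIDSample P prob X) {φ : 𝒳 → ℝ}
    (hφ : Integrable φ P) :
    ∀ᵐ ω ∂prob, Tendsto (fun n => empMean fun i : Fin n => φ (X i ω)) atTop (𝓝 (∫ x, φ x ∂P)) := by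
  -- independence is transported by measurable functions: pass to a measurable version of `φ`
  set ψ := hφ.1.mk φ with hψ
  have hψm : Measurable ψ := hφ.1.stronglyMeasurable_mk.measurable
  have hφψ : φ =ᵐ[P] ψ := hφ.1.ae_eq_mk
  have hψi : Integrable ψ P := hφ.congr hφψ
  have heq : ∀ᵐ ω ∂prob, ∀ i, φ (X i ω) = ψ (X i ω) := ae_all_iff.2 fun i =>
    (hX.measurePreserving i).quasiMeasurePreserving.ae hφψ
  have hlaw := strong_law_ae_real (μ := prob) (fun i ω => ψ (X i ω))
    ((hX.measurePreserving 0).integrable_comp_of_integrable hψi)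
    (fun i j hij => (hX.indep.indepFun hij).comp hψm hψm)
    (fun i => (IdentDistrib.comp ⟨(hX.measurable i).aemeasurable, (hX.measurable 0).aemeasurable,
      by rw [hX.law i, hX.law 0]⟩ hψm))
  have hint : ∫ ω, ψ (X 0 ω) ∂prob = ∫ x, φ x ∂P := by
    rw [integral_congr_ae hφψ, ← hX.law 0, integral_map (hX.measurable 0).aemeasurable
      hψm.aestronglyMeasurable]
  filter_upwards [heq, hlaw] with ω h1 h2
  rw [hint] at h2
  refine h2.congr fun n => ?_
  rw [← empMean_eq_sum_range_div]
  simp only [h1]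

/-- Chebyshev's inequality: empirical means are within `O_p(1 / √n)` of their expectation. -/
theorem IsIIDSample.empMean_sub_isBigO [IsProbabilityMeasure prob] (hX : IsIIDSample P prob X)
    {φ : 𝒳 → ℝ} (hφm : Measurable φ) (hφ : MemLp φ 2 P) :
    HoldsInProbability prob fun M n ω =>
      |(empMean fun i : Fin n => φ (X i ω)) - ∫ x, φ x ∂P| ≤ M / √(n : ℝ) := by
  set V : ℝ := variance φ P with hV
  have hV0 : 0 ≤ V := variance_nonneg _ _
  have hmem : ∀ i, MemLp (fun ω => φ (X i ω)) 2 prob := fun i =>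
    hφ.comp_measurePreserving (hX.measurePreserving i)
  have hvar : ∀ i, variance (fun ω => φ (X i ω)) prob = V := fun i => by
    rw [hV, ← hX.law i, variance_map hφm.aemeasurable (hX.measurable i).aemeasurable]
    rfl
  have hmean : ∀ i, ∫ ω, φ (X i ω) ∂prob = ∫ x, φ x ∂P := fun i => by
    rw [← hX.law i, integral_map (hX.measurable i).aemeasurable hφm.aestronglyMeasurable]
  have hcheb : ∀ M : ℝ, 0 < M → ∀ n : ℕ, 0 < n →
      prob {ω | ¬ |(empMean fun i : Fin n => φ (X i ω)) - ∫ x, φ x ∂P| ≤ M / √(n : ℝ)} ≤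
        ENNReal.ofReal (V / M ^ 2) := by
    intro M hM n hn
    have hn' : (0 : ℝ) < n := by exact_mod_cast hn
    set T : Ω → ℝ := ∑ i ∈ Finset.range n, fun ω => φ (X i ω) with hT
    have hTapp : ∀ ω, T ω = ∑ i ∈ Finset.range n, φ (X i ω) := fun ω => by
      rw [hT, Finset.sum_apply]
    have hTm : MemLp T 2 prob := memLp_finsetSum' _ fun i _ => hmem i
    have hTvar : variance T prob = n * V := by
      rw [hT, IndepFun.variance_sum (fun i _ => hmem i)
        (fun i _ j _ hij => (hX.indep.indepFun hij).comp hφm hφm)]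
      simp [hvar]
    have hTmean : ∫ ω, T ω ∂prob = n * ∫ x, φ x ∂P := by
      simp_rw [hTapp]
      rw [integral_finsetSum _ fun i _ => (hmem i).integrable (by norm_num)]
      simp [hmean]
    have hsq : 0 < √(n : ℝ) := Real.sqrt_pos.2 hn'
    have hc := meas_ge_le_variance_div_sq hTm (c := M * √n) (by positivity)
    rw [hTvar, hTmean, mul_pow, Real.sq_sqrt hn'.le] at hc
    refine (measure_mono fun ω hω => ?_).trans (hc.trans (le_of_eq ?_))
    · simp only [Set.mem_ofPred_eq, not_le] at hω ⊢
      rw [empMean_eq_sum_range_div (fun i => φ (X i ω)), ← hTapp, div_lt_iff₀ hsq] at hω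
      have h1 : T ω - n * ∫ x, φ x ∂P = n * (T ω / n - ∫ x, φ x ∂P) := by field_simp
      have h2 : (n : ℝ) = √n * √n := (Real.mul_self_sqrt hn'.le).symm
      rw [h1, abs_mul, abs_of_pos hn']
      calc M * √n ≤ (|T ω / n - ∫ x, φ x ∂P| * √n) * √n := by gcongr
        _ = n * |T ω / n - ∫ x, φ x ∂P| := by rw [mul_assoc, ← h2, mul_comm]
    · congr 1
      field_simp
  intro ε hε
  have hlim : Tendsto (fun M : ℝ => ENNReal.ofReal (V / M ^ 2)) atTop (𝓝 0) := by
    have := ENNReal.tendsto_ofReal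
      ((tendsto_pow_atTop (α := ℝ) (two_ne_zero)).const_div_atTop V)
    simpa using this
  obtain ⟨M₀, h0⟩ := eventually_atTop.1
    ((hlim.eventually (ge_mem_nhds hε)).and (eventually_gt_atTop 0))
  refine ⟨M₀, fun M hM => ?_⟩
  filter_upwards [eventually_gt_atTop 0] with n hn
  exact (hcheb M (h0 M hM).2 n hn).trans (h0 M hM).1

/-- Weak law of large numbers for functions of the observations. -/
theorem IsIIDSample.empMean_sub_lt [IsFiniteMeasure prob] (hX : IsIIDSample P prob X)
    {φ : 𝒳 → ℝ} (hφ : Integrable φ P) {t : ℝ} (ht : 0 < t) :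
    HoldsInProbability prob fun _ n ω =>
      |(empMean fun i : Fin n => φ (X i ω)) - ∫ x, φ x ∂P| < t :=
  TendstoInMeasure.holdsInProbability (tendstoInMeasure_of_tendsto_ae
    (fun n => hX.aestronglyMeasurable_empMean hφ.1 n) (hX.ae_tendsto_empMean hφ)) ht

/-- Consistency of empirical covariances. -/
theorem IsIIDSample.empCov_sub_lt [IsProbabilityMeasure P] [IsFiniteMeasure prob]
    (hX : IsIIDSample P prob X)
    {φ ψ : 𝒳 → ℝ} (hφ : MemLp φ 2 P) (hψ : MemLp ψ 2 P) {t : ℝ} (ht : 0 < t) :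
    HoldsInProbability prob fun _ n ω =>
      |(empMean (fun i : Fin n => φ (X i ω) * ψ (X i ω)) -
        empMean (fun i : Fin n => φ (X i ω)) * empMean (fun i : Fin n => ψ (X i ω))) -
          covariance φ ψ P| < t := by
  have h1 : Integrable (fun x => φ x * ψ x) P := hφ.integrable_mul hψ
  have h2 := hφ.integrable one_le_two
  have h3 := hψ.integrable one_le_two
  refine TendstoInMeasure.holdsInProbability (tendstoInMeasure_of_tendsto_ae (fun n => ?_) ?_) ht
  · exact (hX.aestronglyMeasurable_empMean h1.1 n).sub
      ((hX.aestronglyMeasurable_empMean h2.1 n).mul (hX.aestronglyMeasurable_empMean h3.1 n))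
  · rw [covariance_eq_sub hφ hψ]
    filter_upwards [hX.ae_tendsto_empMean h1, hX.ae_tendsto_empMean h2,
      hX.ae_tendsto_empMean h3] with ω k1 k2 k3
    exact k1.sub (k2.mul k3)

end Sample

/-! ### Sample moments of the likelihood-as-data vectors -/

section ShiftedLaD

variable {𝒳 : Type*} {K : ℕ} {d : Fin K → ℕ}

/-- The LaD vectors `ℓ_k(x_i; θ̂_k(x_1, …, x_n)) + s_k` with a common shift `s` of the
coordinates. -/
noncomputable def shiftedLadVectors {n : ℕ}
    (ℓ : (k : Fin K) → 𝒳 → EuclideanSpace ℝ (Fin (d k)) → ℝ)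
    (θhat : (k : Fin K) → (Fin n → 𝒳) → EuclideanSpace ℝ (Fin (d k))) (s : Fin K → ℝ)
    (x : Fin n → 𝒳) : Fin n → EuclideanSpace ℝ (Fin K) :=
  fun i => WithLp.toLp 2 fun k => ℓ k (x i) (θhat k x) + s k

theorem shiftedLadVectors_zero {n : ℕ}
    (ℓ : (k : Fin K) → 𝒳 → EuclideanSpace ℝ (Fin (d k)) → ℝ)
    (θhat : (k : Fin K) → (Fin n → 𝒳) → EuclideanSpace ℝ (Fin (d k))) (x : Fin n → 𝒳) :
    shiftedLadVectors ℓ θhat (fun _ => 0) x = ladVectors ℓ θhat x := by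
  funext i
  ext k
  simp [shiftedLadVectors, ladVectors]

theorem shiftedLadVectors_bias {n : ℕ}
    (ℓ : (k : Fin K) → 𝒳 → EuclideanSpace ℝ (Fin (d k)) → ℝ)
    (θhat : (k : Fin K) → (Fin n → 𝒳) → EuclideanSpace ℝ (Fin (d k))) (x : Fin n → 𝒳) :
    shiftedLadVectors ℓ θhat (fun k => (d k : ℝ) / (2 * n)) x = ladVectorsBC ℓ θhat x := rfl

end ShiftedLaD

section LaD

variable {𝒳 : Type*} [MeasurableSpace 𝒳] {P : Measure 𝒳}
  {Ω : Type*} [MeasurableSpace Ω] {prob : Measure Ω} {X : ℕ → Ω → 𝒳}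

theorem LossRegular.measurable_loss_apply {d : ℕ} {Θ : Set (EuclideanSpace ℝ (Fin d))}
    {ℓ : 𝒳 → EuclideanSpace ℝ (Fin d) → ℝ} {θs : EuclideanSpace ℝ (Fin d)}
    (h : LossRegular P Θ ℓ θs) : Measurable fun x => ℓ x θs :=
  h.measurable_loss.comp (g := fun p : 𝒳 × Θ => ℓ p.1 p.2)
    (f := fun x => (x, ⟨θs, h.mem_riskMinimizers.1⟩)) (measurable_id.prodMk measurable_const)

/-- Plugging in a root-`n` consistent estimator, and shifting by `O(1 / √n)`, changes the losses
by `O_p(1 / √n)` in mean square. Since `H` is only integrable, the average of `H²` is bounded by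
`n` times the squared average of `H`; the factor `‖θ̂ - θ*‖⁴ = O_p(1 / n²)` absorbs this. -/
theorem LossRegular.empMean_sq_sub_isBigO [IsFiniteMeasure prob] {d : ℕ}
    {Θ : Set (EuclideanSpace ℝ (Fin d))} {ℓ : 𝒳 → EuclideanSpace ℝ (Fin d) → ℝ}
    {θs : EuclideanSpace ℝ (Fin d)} (h : LossRegular P Θ ℓ θs) (hX : IsIIDSample P prob X)
    {θhat : (n : ℕ) → (Fin n → 𝒳) → EuclideanSpace ℝ (Fin d)}
    (hrate : IsBigOInProbability prob (fun n ω => ‖θhat n (fun i => X i ω) - θs‖)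
      (fun n => 1 / √(n : ℝ)))
    {s : ℕ → ℝ} {C : ℝ} (hs : ∀ n, |s n| ≤ C / √(n : ℝ)) :
    HoldsInProbability prob fun M n ω =>
      empMean (fun i : Fin n => (ℓ (X i ω) (θhat n fun i => X i ω) + s n - ℓ (X i ω) θs) ^ 2) ≤
        (M / √(n : ℝ)) ^ 2 := by
  obtain ⟨r, hr, -, -, hC2, H, hH0, hHint, hH⟩ := h.local_regularity
  set A : ℝ := (∫ x, ‖gradient (ℓ x) θs‖ ^ 2 ∂P) + 1 with hA
  set B : ℝ := (∫ x, H x ∂P) + 1 with hB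
  have hall := (hrate.holdsInProbability fun n => by positivity).and
    ((hX.empMean_sub_lt h.gradient_sq_integrable one_pos).and (hX.empMean_sub_lt hHint one_pos))
  clear_value A B
  refine hall.mono (fun M => √(4 * M ^ 2 * A + 4 * M ^ 4 * B ^ 2 + 2 * C ^ 2))
    fun M hM M' hM' => ?_
  have hsmall : ∀ᶠ n : ℕ in atTop, M / √(n : ℝ) < r :=
    ((Real.tendsto_sqrt_atTop.comp tendsto_natCast_atTop_atTop).const_div_atTop M).eventually
      (gt_mem_nhds hr)
  filter_upwards [hsmall, eventually_gt_atTop 0] with n hnr hn ω ⟨hρ, hG, hHe⟩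
  have hn' : (0 : ℝ) < n := by exact_mod_cast hn
  set θ := θhat n fun i => X i ω with hθ
  set ρ := ‖θ - θs‖ with hρdef
  have hρ0 : 0 ≤ ρ := norm_nonneg _
  rw [abs_of_nonneg hρ0, mul_one_div] at hρ
  have hmem : θ ∈ Metric.ball θs r := by
    rw [Metric.mem_ball, dist_eq_norm]; exact hρ.trans_lt hnr
  have hGA : empMean (fun i : Fin n => ‖gradient (ℓ (X i ω)) θs‖ ^ 2) ≤ A := by
    linarith [(abs_lt.1 hG).2]
  have hHB : empMean (fun i : Fin n => H (X i ω)) ≤ B := by linarith [(abs_lt.1 hHe).2]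
  have hHm0 : 0 ≤ empMean (fun i : Fin n => H (X i ω)) := empMean_nonneg fun i => hH0 _
  have hA0 : 0 ≤ A := (empMean_nonneg fun i => sq_nonneg _).trans hGA
  have hpt : ∀ i : Fin n, (ℓ (X i ω) θ + s n - ℓ (X i ω) θs) ^ 2 ≤
      (4 * ρ ^ 2) * ‖gradient (ℓ (X i ω)) θs‖ ^ 2 + ((4 * ρ ^ 4) * H (X i ω) ^ 2 +
        2 * s n ^ 2) := by
    intro i
    have h1 := abs_sub_le_of_frobeniusNorm_hessianMatrix_le (hC2 (X i ω)) (hH (X i ω)) hmem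
    have h2 : (ℓ (X i ω) θ - ℓ (X i ω) θs) ^ 2 ≤
        (‖gradient (ℓ (X i ω)) θs‖ * ρ + H (X i ω) * ρ ^ 2) ^ 2 := by
      rw [← sq_abs (ℓ (X i ω) θ - ℓ (X i ω) θs)]
      gcongr
    -- `(u + s)² ≤ 2 u² + 2 s²` and `(g ρ + h ρ²)² ≤ 2 g² ρ² + 2 h² ρ⁴`
    nlinarith [sq_nonneg (ℓ (X i ω) θ - ℓ (X i ω) θs - s n),
      sq_nonneg (‖gradient (ℓ (X i ω)) θs‖ * ρ - H (X i ω) * ρ ^ 2)]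
  have hHsq : empMean (fun i : Fin n => H (X i ω) ^ 2) ≤
      n * empMean (fun i : Fin n => H (X i ω)) ^ 2 := by
    have h1 := Finset.sum_sq_le_sq_sum_of_nonneg (s := Finset.univ)
      (f := fun i : Fin n => H (X i ω)) fun i _ => hH0 _
    calc empMean (fun i : Fin n => H (X i ω) ^ 2)
        ≤ (n : ℝ)⁻¹ * (∑ i : Fin n, H (X i ω)) ^ 2 := by unfold empMean; gcongr
      _ = _ := by unfold empMean; field_simp
  have hρ2 : ρ ^ 2 ≤ M ^ 2 / n := by
    calc ρ ^ 2 ≤ (M / √(n : ℝ)) ^ 2 := by gcongr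
      _ = M ^ 2 / n := by rw [div_pow, Real.sq_sqrt hn'.le]
  have hs2 : s n ^ 2 ≤ C ^ 2 / n := by
    calc s n ^ 2 = |s n| ^ 2 := (sq_abs _).symm
      _ ≤ (C / √(n : ℝ)) ^ 2 := by gcongr; exact hs n
      _ = C ^ 2 / n := by rw [div_pow, Real.sq_sqrt hn'.le]
  calc _ ≤ empMean fun i : Fin n => (4 * ρ ^ 2) * ‖gradient (ℓ (X i ω)) θs‖ ^ 2 +
          ((4 * ρ ^ 4) * H (X i ω) ^ 2 + 2 * s n ^ 2) := empMean_mono hpt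
    _ = (4 * ρ ^ 2) * empMean (fun i : Fin n => ‖gradient (ℓ (X i ω)) θs‖ ^ 2) +
          ((4 * (ρ ^ 2) ^ 2) * empMean (fun i : Fin n => H (X i ω) ^ 2) + 2 * s n ^ 2) := by
        rw [empMean_add, empMean_add, empMean_const_mul, empMean_const_mul,
          empMean_const hn.ne']
        ring
    _ ≤ (4 * (M ^ 2 / n)) * A + ((4 * (M ^ 2 / n) ^ 2) * (n * B ^ 2) + 2 * (C ^ 2 / n)) := by
        gcongr
        · exact empMean_nonneg fun i => sq_nonneg _
        · exact empMean_nonneg fun i => sq_nonneg _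
        · exact hHsq.trans (by gcongr)
    _ = (4 * M ^ 2 * A + 4 * M ^ 4 * B ^ 2 + 2 * C ^ 2) / n := by
        field_simp
        ring
    _ = (√(4 * M ^ 2 * A + 4 * M ^ 4 * B ^ 2 + 2 * C ^ 2) / √(n : ℝ)) ^ 2 := by
        rw [div_pow, Real.sq_sqrt hn'.le, Real.sq_sqrt]
        positivity
    _ ≤ (M' / √(n : ℝ)) ^ 2 := by gcongr

theorem norm_le_sum_abs_apply {K : ℕ} (x : EuclideanSpace ℝ (Fin K)) : ‖x‖ ≤ ∑ k, |x k| := by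
  conv_lhs => rw [euclideanSpace_eq_sum_single x]
  refine (norm_sum_le _ _).trans (le_of_eq (Finset.sum_congr rfl fun k _ => ?_))
  rw [norm_smul, PiLp.norm_single, norm_one, mul_one, Real.norm_eq_abs]

theorem abs_div_two_mul_le (m n : ℕ) : |(m : ℝ) / (2 * n)| ≤ m / √(n : ℝ) := by
  rcases Nat.eq_zero_or_pos n with rfl | hn
  · simp
  · have hn' : (1 : ℝ) ≤ n := by exact_mod_cast hn
    have h1 : √(n : ℝ) ≤ n := Real.sqrt_le_iff.2 ⟨by linarith, by nlinarith⟩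
    have h2 : 0 < √(n : ℝ) := Real.sqrt_pos.2 (by linarith)
    rw [abs_of_nonneg (by positivity)]
    exact div_le_div_of_nonneg_left (Nat.cast_nonneg m) h2 (by linarith)

variable {K : ℕ} {d : Fin K → ℕ}

/-- The sample mean of shifted LaD vectors is root-`n` consistent and their sample covariance is
consistent. -/
theorem shiftedLadVectors_holdsInProbability [IsProbabilityMeasure P] [IsProbabilityMeasure prob]
    (hX : IsIIDSample P prob X) {Θ : (k : Fin K) → Set (EuclideanSpace ℝ (Fin (d k)))}
    {ℓ : (k : Fin K) → 𝒳 → EuclideanSpace ℝ (Fin (d k)) → ℝ}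
    {θs : (k : Fin K) → EuclideanSpace ℝ (Fin (d k))}
    (hmoment : ∀ k, MemLp (fun x => ℓ k x (θs k)) 2 P)
    (hreg : ∀ k, LossRegular P (Θ k) (ℓ k) (θs k))
    {θhat : (n : ℕ) → (k : Fin K) → (Fin n → 𝒳) → EuclideanSpace ℝ (Fin (d k))}
    (hθrate : ∀ k, IsBigOInProbability prob
      (fun n ω => ‖θhat n k (fun i => X i ω) - θs k‖) (fun n => 1 / √(n : ℝ)))
    {s : ℕ → Fin K → ℝ} {C : Fin K → ℝ} (hs : ∀ n k, |s n k| ≤ C k / √(n : ℝ))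
    {τ : ℝ} (hτ : 0 < τ) :
    HoldsInProbability prob fun M n ω =>
      ‖sampleMean (shiftedLadVectors ℓ (θhat n) (s n) fun i : Fin n => X i ω) -
          trueMean P ℓ θs‖ ≤ M / √(n : ℝ) ∧
        ∀ j k, |sampleCov (shiftedLadVectors ℓ (θhat n) (s n) fun i : Fin n => X i ω) j k -
          trueCov P ℓ θs j k| ≤ τ := by
  have hall := (HoldsInProbability.forall fun k =>
      (hreg k).empMean_sq_sub_isBigO hX (hθrate k) (fun n => hs n k)).and
    ((HoldsInProbability.forall fun k =>
      hX.empMean_sub_isBigO (hreg k).measurable_loss_apply (hmoment k)).and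
    ((HoldsInProbability.forall fun j => HoldsInProbability.forall fun k =>
      hX.empCov_sub_lt (hmoment j) (hmoment k) (half_pos hτ)).and
    (HoldsInProbability.forall fun k => hX.empMean_sub_lt (hmoment k).integrable_sq one_pos)))
  set L : ℝ := 1 + ∑ k, ((∫ x, ℓ k x (θs k) ^ 2 ∂P) + 1) with hL
  have hterm : ∀ k, 0 ≤ (∫ x, ℓ k x (θs k) ^ 2 ∂P) + 1 := fun k =>
    add_nonneg (integral_nonneg fun x => sq_nonneg _) zero_le_one
  have hL1 : 1 ≤ L := le_add_of_nonneg_right (Finset.sum_nonneg fun k _ => hterm k)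
  refine hall.mono (fun M => K * (2 * M)) fun M hM M' hM' => ?_
  have hκ : Tendsto (fun n : ℕ => M / √(n : ℝ)) atTop (𝓝 0) :=
    (Real.tendsto_sqrt_atTop.comp tendsto_natCast_atTop_atTop).const_div_atTop M
  have hsmall : ∀ᶠ n : ℕ in atTop,
      2 * (2 * (M / √(n : ℝ)) * L + (M / √(n : ℝ)) ^ 2) < τ / 2 := by
    have h1 : Tendsto (fun n : ℕ => 2 * (2 * (M / √(n : ℝ)) * L + (M / √(n : ℝ)) ^ 2)) atTop
        (𝓝 (2 * (2 * 0 * L + 0 ^ 2))) :=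
      (((hκ.const_mul 2).mul_const L).add (hκ.pow 2)).const_mul 2
    exact h1.eventually (gt_mem_nhds (by simpa using hτ))
  filter_upwards [hsmall, eventually_gt_atTop 0] with n hnτ hn ω ⟨hD, hY, hcov, hsq⟩
  set Z := shiftedLadVectors ℓ (θhat n) (s n) fun i : Fin n => X i ω with hZ
  set Y : Fin n → EuclideanSpace ℝ (Fin K) := fun i => WithLp.toLp 2 fun k => ℓ k (X i ω) (θs k)
    with hYdef
  have hY2 : ∀ k, empMean (fun i => Y i k ^ 2) ≤ L ^ 2 := fun k => by
    have h1 := (abs_lt.1 (hsq k)).2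
    have h2 : (∫ x, ℓ k x (θs k) ^ 2 ∂P) + 1 ≤ ∑ k, ((∫ x, ℓ k x (θs k) ^ 2 ∂P) + 1) :=
      Finset.single_le_sum (f := fun k => (∫ x, ℓ k x (θs k) ^ 2 ∂P) + 1)
        (fun k _ => hterm k) (Finset.mem_univ k)
    have h3 : empMean (fun i => Y i k ^ 2) ≤ L := by
      simp only [hYdef]
      linarith
    nlinarith
  obtain ⟨hm, hc⟩ := sampleMean_sampleCov_perturbation hn.ne' (Y := Y) (Z := Z)
    (κ := M / √(n : ℝ)) (by positivity) (zero_le_one.trans hL1) (fun k => hD k) hY2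
  constructor
  · have hcoord : ∀ k, |(sampleMean Z - trueMean P ℓ θs) k| ≤ 2 * M / √(n : ℝ) := fun k => by
      have h1 := hm k
      have h2 : |sampleMean Y k - trueMean P ℓ θs k| ≤ M / √(n : ℝ) := by
        rw [sampleMean_apply]; exact hY k
      calc |(sampleMean Z - trueMean P ℓ θs) k|
          = |(sampleMean Z k - sampleMean Y k) + (sampleMean Y k - trueMean P ℓ θs k)| := by
            rw [PiLp.sub_apply]; congr 1; ring
        _ ≤ M / √(n : ℝ) + M / √(n : ℝ) := (abs_add_le _ _).trans (add_le_add h1 h2)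
        _ = _ := by ring
    calc _ ≤ ∑ k, |(sampleMean Z - trueMean P ℓ θs) k| := norm_le_sum_abs_apply _
      _ ≤ ∑ _k : Fin K, 2 * M / √(n : ℝ) := Finset.sum_le_sum fun k _ => hcoord k
      _ = K * (2 * M) / √(n : ℝ) := by simp [mul_div_assoc]
      _ ≤ _ := by gcongr
  · intro j k
    have h1 := hc j k
    have h2 : |sampleCov Y j k - trueCov P ℓ θs j k| ≤ τ / 2 := by
      rw [sampleCov_apply hn.ne']; exact (hcov j k).le
    calc |sampleCov Z j k - trueCov P ℓ θs j k|
        = |(sampleCov Z j k - sampleCov Y j k) + (sampleCov Y j k - trueCov P ℓ θs j k)| := by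
          congr 1; ring
      _ ≤ τ / 2 + τ / 2 := (abs_add_le _ _).trans (add_le_add (h1.trans hnτ.le) h2)
      _ = τ := by ring

/-! ### Consistency of the score -/

/-- Consistency of the score computed from shifted LaD vectors: with probability close to one the
sample moments satisfy the hypotheses of `exists_niwPosterior_concentration`, whose conclusion is
what `exists_eventually_abs_slcScore_sub_lt` needs. -/
theorem tendstoInMeasure_slcScore_shiftedLadVectors [IsProbabilityMeasure P]
    [IsProbabilityMeasure prob]
    (hX : IsIIDSample P prob X) {Θ : (k : Fin K) → Set (EuclideanSpace ℝ (Fin (d k)))}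
    {ℓ : (k : Fin K) → 𝒳 → EuclideanSpace ℝ (Fin (d k)) → ℝ}
    {θs : (k : Fin K) → EuclideanSpace ℝ (Fin (d k))} (c : Fin K → ℝ≥0)
    (hmoment : ∀ k, MemLp (fun x => ℓ k x (θs k)) 2 P)
    (hcov : (trueCov P ℓ θs).PosDef)
    (hreg : ∀ k, LossRegular P (Θ k) (ℓ k) (θs k))
    {θhat : (n : ℕ) → (k : Fin K) → (Fin n → 𝒳) → EuclideanSpace ℝ (Fin (d k))}
    (hθrate : ∀ k, IsBigOInProbability prob
      (fun n ω => ‖θhat n k (fun i => X i ω) - θs k‖) (fun n => 1 / √(n : ℝ)))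
    {s : ℕ → Fin K → ℝ} {C : Fin K → ℝ} (hs : ∀ n k, |s n k| ≤ C k / √(n : ℝ))
    (μ₀ : EuclideanSpace ℝ (Fin K)) {l₀ : ℝ} (hl₀ : 0 < l₀)
    {Ψ₀ : Matrix (Fin K) (Fin K) ℝ} (hΨ₀ : Ψ₀.PosDef) {ν₀ : ℝ} (hν₀ : (K : ℝ) - 1 < ν₀)
    {δ : ℝ} (hgap : ∀ k, δ ≠ trueMean P ℓ θs k - ⨅ j, trueMean P ℓ θs j)
    {α : ℕ → ℝ} (hα0 : ∀ n, 0 ≤ α n) (hαtop : Tendsto α atTop atTop)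
    (hαo : α =o[atTop] fun n : ℕ => √(n : ℝ)) (k : Fin K) :
    TendstoInMeasure prob
      (fun (n : ℕ) ω => slcScore c δ (α n) (niwPosterior μ₀ l₀ Ψ₀ ν₀
        (shiftedLadVectors ℓ (θhat n) (s n) fun i : Fin n => X i ω)) k)
      atTop (fun _ => Set.indicator (bestModels c δ (trueMean P ℓ θs)) 1 k) := by
  refine tendstoInMeasure_iff_norm.2 fun ε hε => ENNReal.tendsto_nhds_zero.2 fun ε' hε' => ?_
  obtain ⟨η, hη, hscore⟩ := exists_eventually_abs_slcScore_sub_lt c hgap hα0 hαtop hαo k hε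
  obtain ⟨τ, hτ, hpost⟩ := exists_niwPosterior_concentration (trueMean P ℓ θs) hcov μ₀ hl₀ hΨ₀ hν₀
  obtain ⟨M₀, hM₀⟩ :=
    shiftedLadVectors_holdsInProbability hX hmoment hreg hθrate hs hτ ε' hε'
  obtain ⟨M', hM'⟩ := hpost (max M₀ 0) (le_max_right _ _) (ENNReal.ofReal η)
    (ENNReal.ofReal_pos.2 hη)
  filter_upwards [hM₀ _ (le_max_left M₀ 0), hM', hscore M'] with n h1 h2 h3
  refine (measure_mono fun ω hω hgood => ?_).trans h1
  obtain ⟨hprob, hconc⟩ := h2 _ hgood.1 hgood.2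
  exact absurd (h3 _ hprob hconc) (not_lt.2 hω)

end LaD

theorem mainTheorem1
    {𝒳 : Type*} [MeasurableSpace 𝒳] (P : Measure 𝒳) [IsProbabilityMeasure P]
    {Ω : Type*} [MeasurableSpace Ω] (prob : Measure Ω) [IsProbabilityMeasure prob]
    -- the observations, i.i.d. with law `P`
    (X : ℕ → Ω → 𝒳) (hXmeas : ∀ i, Measurable (X i)) (hXindep : iIndepFun X prob)
    (hXlaw : ∀ i, prob.map (X i) = P)
    -- the models: parameter sets, losses, population minimizers, complexities
    {K : ℕ} (d : Fin K → ℕ) (Θ : (k : Fin K) → Set (EuclideanSpace ℝ (Fin (d k))))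
    (ℓ : (k : Fin K) → 𝒳 → EuclideanSpace ℝ (Fin (d k)) → ℝ)
    (θs : (k : Fin K) → EuclideanSpace ℝ (Fin (d k)))
    (c : Fin K → ℝ≥0)
    -- finite second moments and positive definite covariance of the losses at `θs`
    (hmoment : ∀ k, MemLp (fun x => ℓ k x (θs k)) 2 P)
    (hcov : (trueCov P ℓ θs).PosDef)
    -- regularity of the losses
    (hreg : ∀ k, LossRegular P (Θ k) (ℓ k) (θs k))
    -- root-`n` consistent estimators
    (θhat : (n : ℕ) → (k : Fin K) → (Fin n → 𝒳) → EuclideanSpace ℝ (Fin (d k)))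
    (hθmeas : ∀ n k, Measurable (θhat n k)) (hθmem : ∀ n k x, θhat n k x ∈ Θ k)
    (hθrate : ∀ k, IsBigOInProbability prob
      (fun n ω => ‖θhat n k (fun i => X i ω) - θs k‖) (fun n => 1 / √(n : ℝ)))
    -- hyperparameters of the NIW prior
    (μ₀ : EuclideanSpace ℝ (Fin K)) (l₀ : ℝ) (hl₀ : 0 < l₀)
    (Ψ₀ : Matrix (Fin K) (Fin K) ℝ) (hΨ₀ : Ψ₀.PosDef) (ν₀ : ℝ) (hν₀ : (K : ℝ) - 1 < ν₀)
    -- tolerance and temperatures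
    (δ : ℝ) (hδ : 0 < δ)
    (hgap : ∀ k, δ ≠ trueMean P ℓ θs k - ⨅ j, trueMean P ℓ θs j)
    (α : ℕ → ℝ) (hα0 : ∀ n, 0 ≤ α n) (hαtop : Tendsto α atTop atTop)
    (hαo : α =o[atTop] fun n : ℕ => √(n : ℝ)) (k : Fin K) :
    TendstoInMeasure prob
      (fun (n : ℕ) ω => slcScore c δ (α n)
        (niwPosterior μ₀ l₀ Ψ₀ ν₀ (ladVectors ℓ (θhat n) fun i : Fin n => X i ω)) k)
      atTop (fun _ => Set.indicator (bestModels c δ (trueMean P ℓ θs)) 1 k) ∧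
    TendstoInMeasure prob
      (fun (n : ℕ) ω => slcScore c δ (α n)
        (niwPosterior μ₀ l₀ Ψ₀ ν₀ (ladVectorsBC ℓ (θhat n) fun i : Fin n => X i ω)) k)
      atTop (fun _ => Set.indicator (bestModels c δ (trueMean P ℓ θs)) 1 k) := by
  have hX : IsIIDSample P prob X := ⟨hXmeas, hXindep, hXlaw⟩
  constructor
  · have h := tendstoInMeasure_slcScore_shiftedLadVectors hX c hmoment hcov hreg hθrate
      (s := fun _ _ => 0) (C := fun _ => 0) (by simp) μ₀ hl₀ hΨ₀ hν₀ hgap hα0 hαtop hαo k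
    simp only [shiftedLadVectors_zero] at h
    exact h
  · have h := tendstoInMeasure_slcScore_shiftedLadVectors hX c hmoment hcov hreg hθrate
      (s := fun n k => (d k : ℝ) / (2 * n)) (C := fun k => d k)
      (fun n k => abs_div_two_mul_le (d k) n) μ₀ hl₀ hΨ₀ hν₀ hgap hα0 hαtop hαo k
    simp only [shiftedLadVectors_bias] at h
    exact h
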